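/- Setting. A robot has $N$ one-degree-of-freedom joints, each revolute or prismatic, with joint limits $-\pi<\theta_l\le\theta\le\theta_u<\pi$ for the angle of a revolute joint and $z_l\le z\le z_u$ for the displacement of a prismatic joint. The tangent-configuration-space (TC-space) variable $s\in\mathbb R^N$ has the coordinate $t=\tan(\theta/2)$ for each revolute joint and $z$ for each prismatic joint, and $\mathcal P_{\lim}=\{s: s_l\le s\le s_u\}$ is the box of joint limits in TC-space. A scene consists of finitely many bodies and a set of pairs of bodies that can collide. Each body $\mathcal A$ is a compact convex subset of $\mathbb R^3$ rigidly attached to a frame at the end of a kinematic chain (a composition of fixed rigid transforms with joint motions: rotation about, or translation along, the local $z$-axis; there are no joints for a fixed obstacle). $\mathcal A(s)$ is the set it occupies at $s$. The pose of the frame is rational in $s$, with positive denominator $g(s)=\prod(1+t_i^2)$ over the revolute joints of the chain. Write $f^v(s)/g(s)$ for the position of the body-fixed point $v$. Each body comes with finitely many polynomials $\gamma_i^{\mathcal A}(s,x,u_{\mathcal A})$, $h_j^{\mathcal A}(s,x,u_{\mathcal A})$ in $s$, $x\in\mathbb R^3$ and additional variables $u_{\mathcal A}$, such that $x\in\mathcal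 A(s)$ if and only if there is $u_{\mathcal A}$ with all $\gamma_i^{\mathcal A}\ge 0$ and all $h_j^{\mathcal A}=0$. They are of one of the following forms. (1) Polytope with vertices $v_1,\dots,v_n$, $u=\mu$: $\mu_i\ge0$, $1-\sum_i\mu_i=0$, $g^n\bigl(x-\sum_i\mu_i f^{v_i}/g\bigr)=0$. (2) Ball with centre $o$ and radius $r\ge0$: $g^2\bigl(r^2-\|x-f^o/g\|^2\bigr)\ge0$. (3) Capsule (convex hull of two balls with centres $o_1,o_2$ and radii $r_1,r_2\ge0$), $u=\mu$: $\mu\ge0$, $1-\mu\ge0$, $g^2\bigl(r_\mu^2-\|x-f^{o_\mu}/g\|^2\bigr)\ge0$, where $r_\mu=\mu r_1+(1-\mu)r_2$ and $f^{o_\mu}=\mu f^{o_1}+(1-\mu)f^{o_2}$. (4) Cylinder (convex hull of two discs with centres $o_1\neq o_2$ and radii $r_1,r_2\ge0$, normal to $o_1-o_2$), $u=(\mu,v)$, $v\in\mathbb R^3$: $\mu\ge0$, $1-\mu\ge0$, $r_\mu^2-v^Tv\ge0$, $v^T(f^{o_1}-f^{o_2})=0$, $g(x-f^{o_\mu}/g-v)=0$.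 (5) Any convex body $\{y:\exists u,\ \gamma_i(y,u)\ge0,\ h_j(y,u)=0\}$, in coordinates $y$ of its own frame, whose description is Archimedean, that is, $n-\|y\|^2-\|u\|^2=\sigma_0+\sum_i\sigma_i\gamma_i+\sum_j\psi_jh_j$ for some $n\in\mathbb N$, sums of squares (SOS) of polynomials $\sigma_0,\sigma_i$, and polynomials $\psi_j$; here $\gamma_i^{\mathcal A},h_j^{\mathcal A}$ are obtained from $\gamma_i,h_j$ by expressing $y$ rationally through $s$ and $x$ and multiplying each by a power of $g$ that gives a polynomial. TC-free is the set of $s\in\mathbb R^N$ with $\mathcal A(s)\cap\mathcal B(s)=\emptyset$ for every pair $(\mathcal A,\mathcal B)$ that can collide. Theorem. Let $\mathcal P=\{s: c_j^Ts\le d_j,\ j=1,\dots,m\}\subseteq\mathcal P_{\lim}$ be a compact polytope contained in TC-free. Then there is a finite $\rho_0$ such that for every $\rho\ge\rho_0$ and every pair $(\mathcal A,\mathcal B)$ that can collide, the following SOS program is feasible: find polynomials in $\mathbb R[s,x,u]$, $u=(u_{\mathcal A},u_{\mathcal B})$, of degree at most $\rho$, with $\lambda_0,\lambda_j^{\mathcal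 P},\lambda_i^{\mathcal A},\lambda_l^{\mathcal B}$ SOS and $\phi_j^{\mathcal A},\phi_k^{\mathcal B}$ arbitrary, such that $$-1=\lambda_0+\sum_{j}\lambda_j^{\mathcal P}(d_j-c_j^Ts)+\sum_i\lambda_i^{\mathcal A}\gamma_i^{\mathcal A}+\sum_j\phi_j^{\mathcal A}h_j^{\mathcal A}+\sum_l\lambda_l^{\mathcal B}\gamma_l^{\mathcal B}+\sum_k\phi_k^{\mathcal B}h_k^{\mathcal B}.$$ -/

import Mathlib

namespace CertTC

open MvPolynomial Matrix

noncomputable section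

/-! ### Systems of polynomial constraints -/

/-- A finite system of polynomial inequalities `0 ≤ ineq i` and equations `eqn j = 0`
in the variables `τ`. -/
structure PolySystem (τ : Type) where
  numIneq : ℕ
  numEq : ℕ
  ineq : Fin numIneq → MvPolynomial τ ℝ
  eqn : Fin numEq → MvPolynomial τ ℝ

/-- The basic semialgebraic set cut out by a polynomial system. -/
def PolySystem.solutions {τ : Type} (D : PolySystem τ) : Set (τ → ℝ) :=
  {z | (∀ i, 0 ≤ eval z (D.ineq i)) ∧ ∀ j, eval z (D.eqn j) = 0}

/-- The Archimedean property of a description by polynomial inequalities and equations: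
`n - ∑ z_t ^ 2` lies in the quadratic module generated by the inequalities plus the ideal
generated by the equations. -/
def PolySystem.IsArchimedean {τ : Type} [Fintype τ] (D : PolySystem τ) : Prop :=
  ∃ (n : ℕ) (lam₀ : MvPolynomial τ ℝ) (lam : Fin D.numIneq → MvPolynomial τ ℝ)
    (phi : Fin D.numEq → MvPolynomial τ ℝ),
    IsSumSq lam₀ ∧ (∀ i, IsSumSq (lam i)) ∧
      C (n : ℝ) - ∑ t, X t ^ 2 =
        lam₀ + ∑ i, lam i * D.ineq i + ∑ j, phi j * D.eqn j

/-! ### Robot kinematics in configuration space -/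

/-- The two types of joints. -/
inductive JointKind
  | revolute
  | prismatic

/-- The joints of a robot with their limits. The bounds `lo i`, `hi i` bound the
configuration-space variable of the joint: the angle `θ` of a revolute joint and the
displacement `z` of a prismatic joint. -/
structure Robot (N : ℕ) where
  kind : Fin N → JointKind
  lo : Fin N → ℝ
  hi : Fin N → ℝ
  lo_le_hi : ∀ i, lo i ≤ hi i
  revolute_limits : ∀ i, kind i = JointKind.revolute → -Real.pi < lo i ∧ hi i < Real.pi

/-- A pose: the map `y ↦ rot * y + pos` of three-dimensional space, that is, the
homogeneous matrix with blocks `rot`, `pos`, `0`, `1`. -/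
structure Pose where
  rot : Matrix (Fin 3) (Fin 3) ℝ
  pos : Fin 3 → ℝ

/-- The pose is a rigid transform. -/
def Pose.IsRigid (T : Pose) : Prop := T.rot ∈ Matrix.specialOrthogonalGroup (Fin 3) ℝ

/-- Composition of poses (product of the homogeneous matrices). -/
def Pose.comp (S T : Pose) : Pose := ⟨S.rot * T.rot, S.rot *ᵥ T.pos + S.pos⟩

/-- The action of a pose on points. -/
def Pose.act (T : Pose) (y : Fin 3 → ℝ) : Fin 3 → ℝ := T.rot *ᵥ y + T.pos

/-- The coordinates, in the moved frame, of a point `x` of the reference frame (for a rigid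
`T` this is the inverse of `T.act`). -/
def Pose.invAct (T : Pose) (x : Fin 3 → ℝ) : Fin 3 → ℝ := T.rotᵀ *ᵥ (x - T.pos)

/-- The motion of a joint: rotation about, or translation along, the `z` axis. -/
def jointPose : JointKind → ℝ → Pose
  | .revolute, q =>
      ⟨!![Real.cos q, -Real.sin q, 0; Real.sin q, Real.cos q, 0; 0, 0, 1], 0⟩
  | .prismatic, q => ⟨1, ![0, 0, q]⟩

/-- A kinematic chain from the reference frame to a frame of the scene: a fixed transform,
followed by joints, each of which is followed by the fixed transform that describes the link
behind it. A frame that is fixed in the reference frame has no joints in its chain. -/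
structure Chain (N : ℕ) where
  base : Pose
  steps : List (Fin N × Pose)
  base_rigid : base.IsRigid
  steps_rigid : ∀ st ∈ steps, st.2.IsRigid

/-- Forward kinematics: the pose of the end of the chain at the configuration `q`. -/
def Chain.pose {N : ℕ} (R : Robot N) (c : Chain N) (q : Fin N → ℝ) : Pose :=
  c.steps.foldl (fun T st => (T.comp (jointPose (R.kind st.1) (q st.1))).comp st.2) c.base

/-! ### Tangent-configuration space (TC-space) -/

/-- The TC-space coordinate of a joint: `t = tan (θ / 2)` for a revolute joint, and the
displacement itself for a prismatic joint. -/
def toTC : JointKind → ℝ → ℝ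
  | .revolute, q => Real.tan (q / 2)
  | .prismatic, q => q

/-- The joint variable with a given TC-space coordinate. -/
def ofTC : JointKind → ℝ → ℝ
  | .revolute, t => 2 * Real.arctan t
  | .prismatic, z => z

/-- The polytope of all points of TC-space that respect the joint limits. -/
def Robot.limits {N : ℕ} (R : Robot N) : Set (Fin N → ℝ) :=
  {s | ∀ i, toTC (R.kind i) (R.lo i) ≤ s i ∧ s i ≤ toTC (R.kind i) (R.hi i)}

/-- The pose of the end of a chain as a function of the TC-space variable `s`. -/
def Chain.poseTC {N : ℕ} (R : Robot N) (c : Chain N) (s : Fin N → ℝ) : Pose :=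
  c.pose R (fun i => ofTC (R.kind i) (s i))

/-! ### Rational forward kinematics -/

/-- A pose with rational entries in `s`: the rotation is `rotNum / den` and the position is
`posNum / den`. -/
structure RatPose (N : ℕ) where
  rotNum : Matrix (Fin 3) (Fin 3) (MvPolynomial (Fin N) ℝ)
  posNum : Fin 3 → MvPolynomial (Fin N) ℝ
  den : MvPolynomial (Fin N) ℝ

def RatPose.comp {N : ℕ} (S T : RatPose N) : RatPose N :=
  ⟨S.rotNum * T.rotNum, S.rotNum *ᵥ T.posNum + T.den • S.posNum, S.den * T.den⟩

/-- A constant pose as a rational pose. -/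
def Pose.toRat (N : ℕ) (T : Pose) : RatPose N :=
  ⟨T.rot.map C, fun i => C (T.pos i), 1⟩

/-- The joint motion in the TC-space variable, from `cos θ = (1 - t ^ 2) / (1 + t ^ 2)` and
`sin θ = 2 * t / (1 + t ^ 2)`. -/
def jointRat {N : ℕ} (i : Fin N) : JointKind → RatPose N
  | .revolute =>
      ⟨!![1 - X i ^ 2, -(2 * X i), 0; 2 * X i, 1 - X i ^ 2, 0; 0, 0, 1 + X i ^ 2], 0,
        1 + X i ^ 2⟩
  | .prismatic => ⟨1, ![0, 0, X i], 1⟩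

/-- The rational forward kinematics of a chain. -/
def Chain.ratPose {N : ℕ} (R : Robot N) (c : Chain N) : RatPose N :=
  c.steps.foldl (fun T st => (T.comp (jointRat st.1 (R.kind st.1))).comp (st.2.toRat N))
    (c.base.toRat N)

/-! ### Polynomials encoding that `x` lies in a moving body

The polynomials live in `ℝ[s, x, u]`, with `s` the TC-space variable, `x` a point of the
reference frame and `u` the additional variables used in the description of the body. -/

/-- The variables `s`, `x` and `u` (with `k` additional variables). -/
abbrev Vars (N k : ℕ) : Type := Fin N ⊕ (Fin 3 ⊕ Fin k)

section encodings

variable {N k : ℕ}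

/-- The variable `x_i`. -/
def xVar (i : Fin 3) : MvPolynomial (Vars N k) ℝ := X (Sum.inr (Sum.inl i))

/-- The variable `u_i`. -/
def uVar (i : Fin k) : MvPolynomial (Vars N k) ℝ := X (Sum.inr (Sum.inr i))

/-- The denominator `g (s)` of the rational forward kinematics of the chain. -/
def denom (R : Robot N) (c : Chain N) : MvPolynomial (Vars N k) ℝ :=
  rename Sum.inl (c.ratPose R).den

/-- The numerator `f^v (s)` of the position `f^v (s) / g (s)` of the point which has the
coordinates `v` in the frame at the end of the chain. -/
def pointNum (R : Robot N) (c : Chain N) (v : Fin 3 → ℝ) :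
    Fin 3 → MvPolynomial (Vars N k) ℝ :=
  fun i => rename Sum.inl
    (((c.ratPose R).rotNum *ᵥ (fun l => C (v l))) i + (c.ratPose R).posNum i)

/-- V-rep polytope, with the convex combination coefficients as additional variables:
`(∏_i g) * (x - ∑_i μ_i * (f^{v_i} / g)) = 0`, `1 - ∑_i μ_i = 0` and `0 ≤ μ_i`. -/
def polytopeSystem (R : Robot N) (c : Chain N) (v : Fin k → Fin 3 → ℝ) :
    PolySystem (Vars N k) :=
  let h : Fin 3 → MvPolynomial (Vars N k) ℝ := fun a =>
    (∏ _i : Fin k, denom R c) * xVar a -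
      ∑ i : Fin k, uVar i * (∏ _l ∈ Finset.univ.erase i, denom R c) * pointNum R c (v i) a
  { numIneq := k
    numEq := 4
    ineq := uVar
    eqn := ![h 0, h 1, h 2, 1 - ∑ i, uVar i] }

/-- Sphere: `0 ≤ g ^ 2 * (r ^ 2 - ‖x - f^o / g‖ ^ 2)`. -/
def sphereSystem (R : Robot N) (c : Chain N) (o : Fin 3 → ℝ) (r : ℝ) :
    PolySystem (Vars N 0) :=
  { numIneq := 1
    numEq := 0
    ineq := ![denom R c ^ 2 * C (r ^ 2) -
      ∑ a, (denom R c * xVar a - pointNum R c o a) ^ 2]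
    eqn := ![] }

/-- Capsule, with additional variable `μ`: `0 ≤ g ^ 2 * (r_μ ^ 2 - ‖x - f^{o_μ} / g‖ ^ 2)`,
`0 ≤ μ` and `0 ≤ 1 - μ`, where `r_μ = μ * r₁ + (1 - μ) * r₂` and
`f^{o_μ} = μ * f^{o₁} + (1 - μ) * f^{o₂}`. -/
def capsuleSystem (R : Robot N) (c : Chain N) (o₁ o₂ : Fin 3 → ℝ) (r₁ r₂ : ℝ) :
    PolySystem (Vars N 1) :=
  let mu : MvPolynomial (Vars N 1) ℝ := uVar 0
  { numIneq := 3
    numEq := 0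
    ineq := ![denom R c ^ 2 * (mu * C r₁ + (1 - mu) * C r₂) ^ 2 -
        ∑ a, (denom R c * xVar a -
          (mu * pointNum R c o₁ a + (1 - mu) * pointNum R c o₂ a)) ^ 2,
      mu, 1 - mu]
    eqn := ![] }

/-- Cylinder, with additional variables `μ` and `v`: `v ⬝ (f^{o₁} - f^{o₂}) = 0`,
`g * (x - f^{o_μ} / g - v) = 0`, `0 ≤ r_μ ^ 2 - v ⬝ v`, `0 ≤ μ` and `0 ≤ 1 - μ`. -/
def cylinderSystem (R : Robot N) (c : Chain N) (o₁ o₂ : Fin 3 → ℝ) (r₁ r₂ : ℝ) :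
    PolySystem (Vars N 4) :=
  let mu : MvPolynomial (Vars N 4) ℝ := uVar 0
  let v : Fin 3 → MvPolynomial (Vars N 4) ℝ := fun a => uVar a.succ
  let h : Fin 3 → MvPolynomial (Vars N 4) ℝ := fun a =>
    denom R c * xVar a - (mu * pointNum R c o₁ a + (1 - mu) * pointNum R c o₂ a) -
      denom R c * v a
  { numIneq := 3
    numEq := 4
    ineq := ![(mu * C r₁ + (1 - mu) * C r₂) ^ 2 - ∑ a, v a ^ 2, mu, 1 - mu]
    eqn := ![∑ a, v a * (pointNum R c o₁ a - pointNum R c o₂ a), h 0, h 1, h 2] }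

/-- `p'` arises from the polynomial `p (y, u)`, where `y` are coordinates in the frame at the
end of the chain, by writing `y` as a rational function of `s` and of the point `x` of the
reference frame, and multiplying by a power of the positive denominator `g (s)`. -/
def IsCleared (R : Robot N) (c : Chain N) (p : MvPolynomial (Fin 3 ⊕ Fin k) ℝ)
    (p' : MvPolynomial (Vars N k) ℝ) : Prop :=
  ∃ e : ℕ, ∀ (s : Fin N → ℝ) (x : Fin 3 → ℝ) (u : Fin k → ℝ),
    eval (Sum.elim s (Sum.elim x u)) p' =
      eval s (c.ratPose R).den ^ e * eval (Sum.elim ((c.poseTC R s).invAct x) u) p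

end encodings

/-- The set of points `y` for which the system in the variables `(y, u)` has a solution. -/
def PolySystem.shadow {k : ℕ} (D : PolySystem (Fin 3 ⊕ Fin k)) : Set (Fin 3 → ℝ) :=
  {y | ∃ u : Fin k → ℝ, Sum.elim y u ∈ D.solutions}

/-- The solid ball (Euclidean norm). -/
def ball (o : Fin 3 → ℝ) (r : ℝ) : Set (Fin 3 → ℝ) :=
  {y | (y - o) ⬝ᵥ (y - o) ≤ r ^ 2}

/-- The disc with centre `o` and radius `r` in the plane through `o` normal to `n`. -/
def disc (o n : Fin 3 → ℝ) (r : ℝ) : Set (Fin 3 → ℝ) :=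
  {y | (y - o) ⬝ᵥ n = 0 ∧ (y - o) ⬝ᵥ (y - o) ≤ r ^ 2}

/-- `Encodes R c K k E` says that `K` is a compact convex body, given in the frame at the end
of the chain `c`, and that `E` is its polynomial description: the system in the variables
`(s, x, u)`, with `k` additional variables `u`, which expresses that `x` lies in the body at
the TC-space point `s`. Besides the four standard geometries this covers every convex body
with an Archimedean semialgebraic description in its own frame (compactness is implied). -/
inductive Encodes {N : ℕ} (R : Robot N) (c : Chain N) :
    Set (Fin 3 → ℝ) → (k : ℕ) → PolySystem (Vars N k) → Prop
  | polytope {k : ℕ} (v : Fin k → Fin 3 → ℝ) :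
      Encodes R c (convexHull ℝ (Set.range v)) k (polytopeSystem R c v)
  | sphere (o : Fin 3 → ℝ) (r : ℝ) (hr : 0 ≤ r) :
      Encodes R c (ball o r) 0 (sphereSystem R c o r)
  | capsule (o₁ o₂ : Fin 3 → ℝ) (r₁ r₂ : ℝ) (hr₁ : 0 ≤ r₁) (hr₂ : 0 ≤ r₂) :
      Encodes R c (convexHull ℝ (ball o₁ r₁ ∪ ball o₂ r₂)) 1
        (capsuleSystem R c o₁ o₂ r₁ r₂)
  | cylinder (o₁ o₂ : Fin 3 → ℝ) (r₁ r₂ : ℝ) (ho : o₁ ≠ o₂) (hr₁ : 0 ≤ r₁) (hr₂ : 0 ≤ r₂) :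
      Encodes R c (convexHull ℝ (disc o₁ (o₁ - o₂) r₁ ∪ disc o₂ (o₁ - o₂) r₂)) 4
        (cylinderSystem R c o₁ o₂ r₁ r₂)
  | semialgebraic {k : ℕ} (D : PolySystem (Fin 3 ⊕ Fin k)) (harch : D.IsArchimedean)
      (hconv : Convex ℝ D.shadow) (ineq' : Fin D.numIneq → MvPolynomial (Vars N k) ℝ)
      (eqn' : Fin D.numEq → MvPolynomial (Vars N k) ℝ)
      (hineq : ∀ i, IsCleared R c (D.ineq i) (ineq' i))
      (heqn : ∀ j, IsCleared R c (D.eqn j) (eqn' j)) :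
      Encodes R c D.shadow k ⟨D.numIneq, D.numEq, ineq', eqn'⟩

/-- A collision body: a compact convex set attached to the end of a kinematic chain, with its
polynomial description. -/
structure Body {N : ℕ} (R : Robot N) where
  chain : Chain N
  shape : Set (Fin 3 → ℝ)
  aux : ℕ
  system : PolySystem (Vars N aux)
  encodes : Encodes R chain shape aux system

/-- The set that the body occupies in task space at the TC-space point `s`. -/
def Body.region {N : ℕ} {R : Robot N} (A : Body R) (s : Fin N → ℝ) : Set (Fin 3 → ℝ) :=
  (A.chain.poseTC R s).act '' A.shape

/-- A scene: the bodies of the robot and of the environment, and the pairs of bodies that can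
collide. -/
structure Scene {N : ℕ} (R : Robot N) where
  numBodies : ℕ
  body : Fin numBodies → Body R
  pairs : Finset (Fin numBodies × Fin numBodies)

/-- TC-free: the points of TC-space at which no two bodies collide. -/
def Scene.free {N : ℕ} {R : Robot N} (S : Scene R) : Set (Fin N → ℝ) :=
  {s | ∀ pr ∈ S.pairs, (S.body pr.1).region s ∩ (S.body pr.2).region s = ∅}

/-! ### The infeasibility certificate program -/

/-- The polyhedron `{s | K s ≤ d}`. -/
def polyhedron {N m : ℕ} (K : Matrix (Fin m) (Fin N) ℝ) (d : Fin m → ℝ) :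
    Set (Fin N → ℝ) :=
  {s | ∀ j, (K *ᵥ s) j ≤ d j}

/-- The variables `s`, `x`, `u = (u_A, u_B)` of the program. -/
abbrev PairVars (N a b : ℕ) : Type := Fin N ⊕ (Fin 3 ⊕ (Fin a ⊕ Fin b))

/-- Inclusion of the variables `s`, `x`, `u_A`. -/
def inclA {N a b : ℕ} : Vars N a → PairVars N a b := Sum.map id (Sum.map id Sum.inl)

/-- Inclusion of the variables `s`, `x`, `u_B`. -/
def inclB {N a b : ℕ} : Vars N b → PairVars N a b := Sum.map id (Sum.map id Sum.inr)

/-- The affine polynomial `d_j - c_j ⬝ s`. -/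
def facet {N m a b : ℕ} (K : Matrix (Fin m) (Fin N) ℝ) (d : Fin m → ℝ) (j : Fin m) :
    MvPolynomial (PairVars N a b) ℝ :=
  C (d j) - ∑ i, C (K j i) * X (Sum.inl i)

/-- The program for the pair `(A, B)` and the region `{s | K s ≤ d}` is feasible with
multiplier polynomials of degree up to `ρ`. -/
def ProgramFeasible {N m : ℕ} {R : Robot N} (K : Matrix (Fin m) (Fin N) ℝ) (d : Fin m → ℝ)
    (A B : Body R) (ρ : ℕ) : Prop :=
  ∃ (lam₀ : MvPolynomial (PairVars N A.aux B.aux) ℝ)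
    (lamP : Fin m → MvPolynomial (PairVars N A.aux B.aux) ℝ)
    (lamA : Fin A.system.numIneq → MvPolynomial (PairVars N A.aux B.aux) ℝ)
    (phiA : Fin A.system.numEq → MvPolynomial (PairVars N A.aux B.aux) ℝ)
    (lamB : Fin B.system.numIneq → MvPolynomial (PairVars N A.aux B.aux) ℝ)
    (phiB : Fin B.system.numEq → MvPolynomial (PairVars N A.aux B.aux) ℝ),
    (IsSumSq lam₀ ∧ (∀ j, IsSumSq (lamP j)) ∧ (∀ i, IsSumSq (lamA i)) ∧
      ∀ l, IsSumSq (lamB l)) ∧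
    (lam₀.totalDegree ≤ ρ ∧ (∀ j, (lamP j).totalDegree ≤ ρ) ∧
      (∀ i, (lamA i).totalDegree ≤ ρ) ∧ (∀ j, (phiA j).totalDegree ≤ ρ) ∧
      (∀ l, (lamB l).totalDegree ≤ ρ) ∧ ∀ j, (phiB j).totalDegree ≤ ρ) ∧
    -1 = lam₀ + ∑ j, lamP j * facet K d j +
      ∑ i, lamA i * rename inclA (A.system.ineq i) +
      ∑ j, phiA j * rename inclA (A.system.eqn j) +
      ∑ l, lamB l * rename inclB (B.system.ineq l) +
      ∑ j, phiB j * rename inclB (B.system.eqn j)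

end

end CertTC

namespace CertTC

open MvPolynomial Matrix

/-! ### Quadratic modules -/

/-! Fix a pair of bodies and let `M` be the quadratic module generated by the facet polynomials and
both bodies' inequalities, plus the ideal of their equations, in `ℝ[s, x, u]`. A certificate of some
degree exists exactly when `-1 ∈ M`. Suppose `-1 ∉ M`. If `M` is Archimedean, Putinar's theorem in
its infeasibility form (`exists_eval_nonneg`) yields a real point `(s, x, u)` at which all of `M` is
nonnegative. Then `s` lies in the polytope and `x` in both bodies at `s` (`Encodes.mem_image_act`),
contradicting collision-freeness. Feasibility is monotone in the degree and there are finitely many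
pairs, so one `ρ₀` serves all of them.

The work is to show that `M` is Archimedean. The elements bounded with respect to `M` form a
subalgebra, so it suffices to bound each variable. For `s` this is Farkas' lemma applied to the
compact polytope (`X_mem_bounded_of_isCompact`). Polynomials in `s`, such as `g` and `f^v`, are then
bounded as well. For `x` and `u` (`Encodes.X_mem_bounded`) the body's constraints bound `u` and
products such as `g * x`. The factor `g` can be cancelled because `g - 1` is a sum of squares
(`mem_bounded_of_mul_mem_bounded`). For a general convex body, the Archimedean certificate in its
own frame is carried to `M` by clearing denominators.

Putinar's theorem is proved by extending `M` to a maximal proper quadratic module. This is total, so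
each bounded element is infinitely close to a unique real number, and that number defines a
character nonnegative on `M`. A character of a polynomial ring is evaluation at a point. -/

/-- A quadratic module of a commutative ring. -/
structure IsQuadraticModule {A : Type*} [CommRing A] (M : Set A) : Prop where
  one_mem : 1 ∈ M
  add_mem : ∀ {a b}, a ∈ M → b ∈ M → a + b ∈ M
  mul_self_mul_mem : ∀ (a) {b}, b ∈ M → a * a * b ∈ M

namespace IsQuadraticModule

variable {A : Type*} [CommRing A] {M : Set A}

theorem zero_mem (hM : IsQuadraticModule M) : 0 ∈ M := by
  simpa using hM.mul_self_mul_mem 0 hM.one_mem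

theorem sumSq_mul_mem (hM : IsQuadraticModule M) {a b : A} (ha : IsSumSq a) (hb : b ∈ M) :
    a * b ∈ M := by
  induction ha with
  | zero => simpa using hM.zero_mem
  | sq_add c _ ih => rw [add_mul]; exact hM.add_mem (hM.mul_self_mul_mem c hb) ih

theorem sumSq_mem (hM : IsQuadraticModule M) {a : A} (ha : IsSumSq a) : a ∈ M := by
  simpa using hM.sumSq_mul_mem ha hM.one_mem

theorem sq_mem (hM : IsQuadraticModule M) (a : A) : a ^ 2 ∈ M :=
  hM.sumSq_mem (by rw [sq]; exact IsSumSq.mul_self a)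

theorem sum_mem (hM : IsQuadraticModule M) {ι : Type*} {I : Finset ι} {f : ι → A}
    (hf : ∀ i ∈ I, f i ∈ M) : ∑ i ∈ I, f i ∈ M :=
  Finset.sum_induction f (· ∈ M) (fun _ _ => hM.add_mem) hM.zero_mem hf

theorem preimage {B : Type*} [CommRing B] {M : Set B} (hM : IsQuadraticModule M)
    (f : A →+* B) : IsQuadraticModule (f ⁻¹' M) where
  one_mem := by simpa using hM.one_mem
  add_mem ha hb := by
    simp only [Set.mem_preimage, map_add] at *
    exact hM.add_mem ha hb
  mul_self_mul_mem a _ hb := by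
    simp only [Set.mem_preimage, map_mul] at *
    exact hM.mul_self_mul_mem (f a) hb

theorem adjoin (hM : IsQuadraticModule M) (a : A) :
    IsQuadraticModule {x | ∃ q ∈ M, ∃ σ, IsSumSq σ ∧ x = q + σ * a} where
  one_mem := ⟨1, hM.one_mem, 0, .zero, by simp⟩
  add_mem := by
    rintro _ _ ⟨q, hq, σ, hσ, rfl⟩ ⟨q', hq', σ', hσ', rfl⟩
    exact ⟨q + q', hM.add_mem hq hq', σ + σ', hσ.add hσ', by ring⟩
  mul_self_mul_mem := by
    rintro c _ ⟨q, hq, σ, hσ, rfl⟩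
    exact ⟨c * c * q, hM.mul_self_mul_mem c hq, c * c * σ, (IsSumSq.mul_self c).mul hσ, by ring⟩

/-- Zorn's lemma applies because the union of a chain omits `-1` as soon as every member does. -/
theorem exists_maximal (hM : IsQuadraticModule M) (hneg : -1 ∉ M) :
    ∃ Q : Set A, IsQuadraticModule Q ∧ M ⊆ Q ∧ -1 ∉ Q ∧
      ∀ Q' : Set A, IsQuadraticModule Q' → Q ⊆ Q' → -1 ∉ Q' → Q' ⊆ Q := by
  obtain ⟨Q, hMQ, hQ⟩ := zorn_subset_nonempty {Q : Set A | IsQuadraticModule Q ∧ -1 ∉ Q} (by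
    intro c hc hchain hne
    refine ⟨⋃₀ c, ⟨⟨?_, ?_, ?_⟩, ?_⟩, fun s hs => Set.subset_sUnion_of_mem hs⟩
    · obtain ⟨s, hs⟩ := hne
      exact ⟨s, hs, (hc hs).1.one_mem⟩
    · rintro a b ⟨s, hs, ha⟩ ⟨t, ht, hb⟩
      rcases hchain.total hs ht with h | h
      · exact ⟨t, ht, (hc ht).1.add_mem (h ha) hb⟩
      · exact ⟨s, hs, (hc hs).1.add_mem ha (h hb)⟩
    · rintro a b ⟨s, hs, hb⟩
      exact ⟨s, hs, (hc hs).1.mul_self_mul_mem a hb⟩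
    · rintro ⟨s, hs, h⟩
      exact (hc hs).2 h) M ⟨hM, hneg⟩
  exact ⟨Q, hQ.prop.1, hMQ, hQ.prop.2, fun Q' h₁ h₂ h₃ => hQ.le_of_ge ⟨h₁, h₃⟩ h₂⟩

variable [Algebra ℝ A]

theorem isSumSq_algebraMap {r : ℝ} (hr : 0 ≤ r) : IsSumSq (algebraMap ℝ A r) := by
  rw [← Real.mul_self_sqrt hr, map_mul]
  exact IsSumSq.mul_self _

theorem algebraMap_mem (hM : IsQuadraticModule M) {r : ℝ} (hr : 0 ≤ r) :
    algebraMap ℝ A r ∈ M :=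
  hM.sumSq_mem (isSumSq_algebraMap hr)

theorem algebraMap_mul_mem (hM : IsQuadraticModule M) {r : ℝ} (hr : 0 ≤ r) {a : A}
    (ha : a ∈ M) : algebraMap ℝ A r * a ∈ M :=
  hM.sumSq_mul_mem (isSumSq_algebraMap hr) ha

theorem mem_of_algebraMap_mul_mem (hM : IsQuadraticModule M) {r : ℝ} (hr : 0 < r) {a : A}
    (ha : algebraMap ℝ A r * a ∈ M) : a ∈ M := by
  have := hM.algebraMap_mul_mem (inv_nonneg.2 hr.le) ha
  rwa [← mul_assoc, ← map_mul, inv_mul_cancel₀ hr.ne', map_one, one_mul] at this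

/-- An element bounded in absolute value by `c` has a square bounded by `c ^ 2`. -/
theorem sq_sub_sq_mem (hM : IsQuadraticModule M) {c : ℝ} (hc : 0 < c) {a : A}
    (h₁ : algebraMap ℝ A c - a ∈ M) (h₂ : algebraMap ℝ A c + a ∈ M) :
    algebraMap ℝ A (c ^ 2) - a ^ 2 ∈ M := by
  refine hM.mem_of_algebraMap_mul_mem (r := 2 * c) (by positivity) ?_
  -- `2c(c² - a²) = (c - a)²(c + a) + (c + a)²(c - a)`.
  have := hM.add_mem (hM.mul_self_mul_mem (algebraMap ℝ A c - a) h₂)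
    (hM.mul_self_mul_mem (algebraMap ℝ A c + a) h₁)
  convert this using 1
  simp only [map_mul, map_pow, map_ofNat]
  ring

/-- An element whose square is bounded by `c` is bounded by `c + 1 / 4`. -/
theorem sub_mem_of_sub_sq_mem (hM : IsQuadraticModule M) {c : ℝ} {a : A}
    (h : algebraMap ℝ A c - a ^ 2 ∈ M) : algebraMap ℝ A (c + 1 / 4) - a ∈ M := by
  -- `c + 1/4 - a = (c - a²) + (a - 1/2)²`.
  have := hM.add_mem h (hM.sq_mem (a - algebraMap ℝ A (1 / 2)))
  convert this using 1
  have h2 : algebraMap ℝ A (1 / 4) = algebraMap ℝ A (1 / 2) ^ 2 := by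
    rw [← map_pow]; norm_num
  have h3 : (2 : A) * algebraMap ℝ A (1 / 2) = 1 := by
    rw [← map_ofNat (algebraMap ℝ A), ← map_mul]; norm_num
  rw [map_add, h2]
  linear_combination a * h3

theorem add_mem_of_sub_sq_mem (hM : IsQuadraticModule M) {c : ℝ} {a : A}
    (h : algebraMap ℝ A c - a ^ 2 ∈ M) : algebraMap ℝ A (c + 1 / 4) + a ∈ M := by
  simpa using hM.sub_mem_of_sub_sq_mem (a := -a) (by simpa using h)

/-- The subalgebra of elements that are bounded with respect to a quadratic module. -/
def bounded (hM : IsQuadraticModule M) : Subalgebra ℝ A where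
  carrier := {a | ∃ c : ℝ, algebraMap ℝ A c - a ^ 2 ∈ M}
  algebraMap_mem' r := ⟨r ^ 2, by simpa using hM.zero_mem⟩
  add_mem' := by
    rintro a b ⟨c, hc⟩ ⟨d, hd⟩
    refine ⟨2 * c + 2 * d, ?_⟩
    -- `2c + 2d - (a + b)² = 2(c - a²) + 2(d - b²) + (a - b)²`.
    have := hM.add_mem (hM.add_mem (hM.add_mem hc hc) (hM.add_mem hd hd)) (hM.sq_mem (a - b))
    convert this using 1
    simp only [map_mul, map_add, map_ofNat]
    ring
  mul_mem' := by
    rintro a b ⟨c, hc⟩ ⟨d, hd⟩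
    -- `|c|d - a²b² = b²(|c| - a²) + |c|(d - b²)`; the absolute value makes the constant a
    -- legitimate multiplier.
    have hc' : algebraMap ℝ A |c| - a ^ 2 ∈ M := by
      have := hM.add_mem hc (hM.algebraMap_mem (sub_nonneg.2 (le_abs_self c)))
      convert this using 1
      rw [map_sub]; ring
    refine ⟨|c| * d, ?_⟩
    have := hM.add_mem (hM.mul_self_mul_mem b hc') (hM.algebraMap_mul_mem (abs_nonneg c) hd)
    convert this using 1
    rw [map_mul]; ring

theorem exists_pos_of_mem_bounded (hM : IsQuadraticModule M) {a : A} (ha : a ∈ hM.bounded) :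
    ∃ c : ℝ, 0 < c ∧ algebraMap ℝ A c - a ∈ M ∧ algebraMap ℝ A c + a ∈ M := by
  obtain ⟨c, hc⟩ := ha
  have hc' : algebraMap ℝ A |c| - a ^ 2 ∈ M := by
    have := hM.add_mem hc (hM.algebraMap_mem (sub_nonneg.2 (le_abs_self c)))
    convert this using 1
    rw [map_sub]; ring
  exact ⟨|c| + 1 / 4, by positivity, hM.sub_mem_of_sub_sq_mem hc', hM.add_mem_of_sub_sq_mem hc'⟩

theorem mem_bounded_of_mem (hM : IsQuadraticModule M) {a : A} {c : ℝ}
    (h₁ : algebraMap ℝ A c - a ∈ M) (h₂ : algebraMap ℝ A c + a ∈ M) : a ∈ hM.bounded := by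
  have hc : 0 ≤ |c| - c := sub_nonneg.2 (le_abs_self c)
  refine ⟨(|c| + 1) ^ 2, hM.sq_sub_sq_mem (by positivity) ?_ ?_⟩
  · convert hM.add_mem h₁ (hM.algebraMap_mem (A := A) (r := |c| - c + 1) (by positivity)) using 1
    simp only [map_sub, map_add]; ring
  · convert hM.add_mem h₂ (hM.algebraMap_mem (A := A) (r := |c| - c + 1) (by positivity)) using 1
    simp only [map_sub, map_add]; ring

/-- If a bounded element dominates a sum of squares, every square in the sum is that of a
bounded element. -/
theorem mem_bounded_of_sub_sum_sq_mem (hM : IsQuadraticModule M) {ι : Type*} {I : Finset ι}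
    {f : ι → A} {b : A} (hb : b ∈ hM.bounded) (h : b - ∑ i ∈ I, f i ^ 2 ∈ M) {i : ι}
    (hi : i ∈ I) : f i ∈ hM.bounded := by
  classical
  obtain ⟨c, -, hc, -⟩ := hM.exists_pos_of_mem_bounded hb
  refine ⟨c, ?_⟩
  have := hM.add_mem (hM.add_mem hc h)
    (hM.sum_mem (I := I.erase i) (f := fun j => f j ^ 2) fun j _ => hM.sq_mem _)
  convert this using 1
  rw [← Finset.add_sum_erase I _ hi]
  ring

/-- A product with an element that is at least `1` is bounded only if the cofactor is. -/
theorem mem_bounded_of_mul_mem_bounded (hM : IsQuadraticModule M) {a g : A}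
    (hg : IsSumSq (g - 1)) (h : g * a ∈ hM.bounded) : a ∈ hM.bounded := by
  obtain ⟨c, hc⟩ := h
  refine ⟨c, ?_⟩
  -- `g² - 1 = (g - 1)² + 2(g - 1)` is a sum of squares, and `c - a² = (c - g²a²) + (g² - 1)a²`.
  have hs : IsSumSq ((g - 1) * (g - 1) + (g - 1) + (g - 1)) :=
    ((IsSumSq.mul_self _).add hg).add hg
  have := hM.add_mem hc (hM.sumSq_mem (hs.mul (IsSumSq.mul_self a)))
  convert this using 1
  ring

/-- With its converse below, this lets each body be treated in its own ring `ℝ[s, x, u_A]`, using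
the preimage of the module of the pair. -/
theorem mem_bounded_of_preimage {B : Type*} [CommRing B] [Algebra ℝ B] {M : Set B}
    (hM : IsQuadraticModule M) (f : A →ₐ[ℝ] B) {a : A}
    (ha : a ∈ (hM.preimage (f : A →+* B)).bounded) : f a ∈ hM.bounded := by
  obtain ⟨c, hc⟩ := ha
  exact ⟨c, by simpa using hc⟩

theorem mem_bounded_preimage {B : Type*} [CommRing B] [Algebra ℝ B] {M : Set B}
    (hM : IsQuadraticModule M) (f : A →ₐ[ℝ] B) {a : A}
    (ha : f a ∈ hM.bounded) : a ∈ (hM.preimage (f : A →+* B)).bounded := by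
  obtain ⟨c, hc⟩ := ha
  exact ⟨c, by simpa using hc⟩

/-! ### The representation theorem for Archimedean quadratic modules -/

/-- `M ∩ -M` is an ideal, because every `b` is a difference of squares: `b = ((b + 1)/2)² - ((b -
1)/2)²`. -/
theorem mul_mem_of_neg_mem (hM : IsQuadraticModule M) {x : A} (h₁ : x ∈ M) (h₂ : -x ∈ M)
    (b : A) : x * b ∈ M := by
  have h := hM.add_mem (hM.mul_self_mul_mem (algebraMap ℝ A (1 / 2) * (b + 1)) h₁)
    (hM.mul_self_mul_mem (algebraMap ℝ A (1 / 2) * (b - 1)) h₂)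
  convert h using 1
  have h3 : (4 : A) * (algebraMap ℝ A (1 / 2) * algebraMap ℝ A (1 / 2)) = 1 := by
    rw [← map_ofNat (algebraMap ℝ A), ← map_mul, ← map_mul]; norm_num
  linear_combination (-x * b) * h3

/-- A maximal proper quadratic module is total. -/
theorem total_of_maximal (hM : IsQuadraticModule M) (hneg : -1 ∉ M)
    (hmax : ∀ Q : Set A, IsQuadraticModule Q → M ⊆ Q → -1 ∉ Q → Q ⊆ M) (a : A) :
    a ∈ M ∨ -a ∈ M := by
  -- By maximality, adjoining an element outside `M` must produce `-1`.
  have key : ∀ b : A, b ∉ M → ∃ q ∈ M, ∃ σ, IsSumSq σ ∧ -1 = q + σ * b := by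
    intro b hb
    by_contra hcon
    exact hb (hmax _ (hM.adjoin b) (fun q hq => ⟨q, hq, 0, .zero, by simp⟩) hcon
      ⟨0, hM.zero_mem, 1, .one, by simp⟩)
  by_contra! hcon
  obtain ⟨q₁, hq₁, σ₁, hσ₁, h₁⟩ := key a hcon.1
  obtain ⟨q₂, hq₂, σ₂, hσ₂, h₂⟩ := key (-a) hcon.2
  -- Eliminating `a` from `-1 = q₁ + σ₁a` and `-1 = q₂ - σ₂a` gives `-σ₁ = σ₂q₁ + σ₁q₂ + σ₂`. So
  -- `σ₁` lies in the ideal `M ∩ -M`, which puts `σ₁a`, and hence `-1`, into `M`.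
  have hσ : -σ₁ ∈ M := by
    have := hM.add_mem (hM.add_mem (hM.sumSq_mul_mem hσ₂ hq₁) (hM.sumSq_mul_mem hσ₁ hq₂))
      (hM.sumSq_mem hσ₂)
    convert this using 1
    linear_combination σ₂ * h₁ + σ₁ * h₂
  exact hneg (h₁ ▸ hM.add_mem hq₁ (hM.mul_mem_of_neg_mem (hM.sumSq_mem hσ₁) hσ a))

/-- `r` is infinitely close to `a` with respect to the quadratic module `M`. -/
def Near (M : Set A) (a : A) (r : ℝ) : Prop :=
  ∀ ε : ℝ, 0 < ε → algebraMap ℝ A (ε + r) - a ∈ M ∧ algebraMap ℝ A (ε - r) + a ∈ M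

theorem nonneg_of_algebraMap_mem (hM : IsQuadraticModule M) (hneg : -1 ∉ M) {r : ℝ}
    (hr : algebraMap ℝ A r ∈ M) : 0 ≤ r := by
  by_contra! h
  refine hneg ?_
  have := hM.algebraMap_mul_mem (inv_nonneg.2 (neg_nonneg.2 h.le)) hr
  rwa [← map_mul, inv_neg, neg_mul, inv_mul_cancel₀ h.ne, map_neg, map_one] at this

/-- The reals inherit the order of `M`, since a proper module contains no negative constant. The
case `a = b` gives uniqueness of the nearby real, and `a = 0` gives nonnegativity on `M`. -/
theorem Near.le_of_sub_mem (hM : IsQuadraticModule M) (hneg : -1 ∉ M) {a b : A} {r s : ℝ}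
    (ha : Near M a r) (hb : Near M b s) (h : b - a ∈ M) : r ≤ s := by
  refine le_of_forall_pos_le_add fun ε hε => ?_
  have := hM.add_mem (hM.add_mem h (hb (ε / 2) (by positivity)).1) (ha (ε / 2) (by positivity)).2
  have h0 := hM.nonneg_of_algebraMap_mem hneg (r := s + ε - r) (by
    convert this using 1
    have : s + ε - r = (ε / 2 + s) + (ε / 2 - r) := by ring
    rw [this, map_add]; ring)
  linarith

theorem Near.add (hM : IsQuadraticModule M) {a b : A} {r s : ℝ} (ha : Near M a r)
    (hb : Near M b s) : Near M (a + b) (r + s) := by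
  intro ε hε
  have h₁ := ha (ε / 2) (by positivity)
  have h₂ := hb (ε / 2) (by positivity)
  constructor
  · convert hM.add_mem h₁.1 h₂.1 using 1
    have : ε + (r + s) = (ε / 2 + r) + (ε / 2 + s) := by ring
    rw [this, map_add]; ring
  · convert hM.add_mem h₁.2 h₂.2 using 1
    have : ε - (r + s) = (ε / 2 - r) + (ε / 2 - s) := by ring
    rw [this, map_add]; ring

theorem Near.const (hM : IsQuadraticModule M) (r : ℝ) : Near M (algebraMap ℝ A r) r := by
  intro ε hε
  have := hM.algebraMap_mem hε.le
  constructor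
  · simpa using this
  · simpa using this

theorem Near.neg {a : A} {r : ℝ} (ha : Near M a r) : Near M (-a) (-r) := by
  intro ε hε
  have := ha ε hε
  constructor
  · simpa [sub_eq_add_neg] using this.2
  · simpa [sub_eq_add_neg] using this.1

theorem Near.smul (hM : IsQuadraticModule M) {a : A} {r : ℝ} (ha : Near M a r) (c : ℝ) :
    Near M (algebraMap ℝ A c * a) (c * r) := by
  have key : ∀ c : ℝ, 0 < c → Near M (algebraMap ℝ A c * a) (c * r) := by
    intro c hc ε hε
    have h := ha (ε / c) (by positivity)
    constructor
    · convert hM.algebraMap_mul_mem hc.le h.1 using 1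
      rw [mul_sub, ← map_mul, mul_add, mul_div_cancel₀ _ hc.ne']
    · convert hM.algebraMap_mul_mem hc.le h.2 using 1
      rw [mul_add, ← map_mul, mul_sub, mul_div_cancel₀ _ hc.ne']
  rcases lt_trichotomy c 0 with h | rfl | h
  · simpa using (key (-c) (by linarith)).neg
  · simpa using Near.const hM (A := A) 0
  · exact key c h

/-- Infinitesimals have infinitesimal squares, and the general case follows by the shift `a² = (a -
r)² + 2ra - r²`. -/
theorem Near.sq (hM : IsQuadraticModule M) {a : A} {r : ℝ} (ha : Near M a r) :
    Near M (a ^ 2) (r ^ 2) := by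
  have key : ∀ b : A, Near M b 0 → Near M (b ^ 2) 0 := by
    intro b hb ε hε
    have h := hb (√ε) (Real.sqrt_pos.2 hε)
    simp only [add_zero, sub_zero] at h ⊢
    refine ⟨?_, hM.add_mem (hM.algebraMap_mem hε.le) (hM.sq_mem b)⟩
    simpa [Real.sq_sqrt hε.le] using hM.sq_sub_sq_mem (Real.sqrt_pos.2 hε) h.1 h.2
  have h₁ : Near M (a + algebraMap ℝ A (-r)) 0 := by
    simpa using ha.add hM (Near.const hM (A := A) (-r))
  have h₂ := ((key _ h₁).add hM (ha.smul hM (2 * r))).add hM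
    (Near.const hM (A := A) (-r ^ 2))
  convert h₂ using 1
  · simp only [map_neg, map_mul, map_pow, map_ofNat]; ring
  · ring

/-- Polarization: `ab = ((a + b)² - (a² + b²))/2`. -/
theorem Near.mul (hM : IsQuadraticModule M) {a b : A} {r s : ℝ} (ha : Near M a r)
    (hb : Near M b s) : Near M (a * b) (r * s) := by
  have h := ((ha.add hM hb).sq hM).add hM ((ha.sq hM).add hM (hb.sq hM)).neg
  have h' := h.smul hM (1 / 2)
  convert h' using 1
  · have h3 : (algebraMap ℝ A (1 / 2)) * (2 : A) = 1 := by
      rw [← map_ofNat (algebraMap ℝ A), ← map_mul]; norm_num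
    linear_combination (-a * b) * h3
  · ring

/-- A Dedekind cut: the nearby real is the supremum of the constants below `a`. Boundedness and
properness make the supremum finite, and totality places `a` below every larger constant. -/
theorem exists_near (hM : IsQuadraticModule M) (hneg : -1 ∉ M)
    (htot : ∀ a : A, a ∈ M ∨ -a ∈ M) {a : A} (ha : a ∈ hM.bounded) : ∃ r, Near M a r := by
  obtain ⟨c, -, hc₁, hc₂⟩ := hM.exists_pos_of_mem_bounded ha
  have hne : {r : ℝ | a - algebraMap ℝ A r ∈ M}.Nonempty := ⟨-c, by simpa [add_comm] using hc₂⟩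
  have hbdd : BddAbove {r : ℝ | a - algebraMap ℝ A r ∈ M} := by
    refine ⟨c, fun r hr => ?_⟩
    have := hM.nonneg_of_algebraMap_mem hneg (r := c - r) (by
      simpa using hM.add_mem hc₁ hr)
    linarith
  refine ⟨sSup {r : ℝ | a - algebraMap ℝ A r ∈ M}, fun ε hε => ⟨?_, ?_⟩⟩
  · rcases htot (a - algebraMap ℝ A (ε + sSup {r : ℝ | a - algebraMap ℝ A r ∈ M})) with h | h
    · have := le_csSup hbdd h
      linarith
    · simpa using h
  · obtain ⟨r, hr, hlt⟩ := exists_lt_of_lt_csSup hne (sub_lt_self _ hε)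
    have := hM.add_mem (hM.algebraMap_mem (A := A) (sub_nonneg.2 hlt.le)) hr
    convert this using 1
    simp only [map_sub]; ring

/-- An Archimedean quadratic module that does not contain `-1` is nonnegative at some
real-valued character. -/
theorem exists_algHom_nonneg (hM : IsQuadraticModule M) (harch : hM.bounded = ⊤)
    (hneg : -1 ∉ M) : ∃ φ : A →ₐ[ℝ] ℝ, ∀ a ∈ M, 0 ≤ φ a := by
  obtain ⟨Q, hQ, hMQ, hnegQ, hmax⟩ := hM.exists_maximal hneg
  have htot := hQ.total_of_maximal hnegQ hmax
  have hb : ∀ a : A, a ∈ hQ.bounded := by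
    intro a
    have ha : a ∈ hM.bounded := harch ▸ Algebra.mem_top
    obtain ⟨c, hc⟩ := ha
    exact ⟨c, hMQ hc⟩
  choose φ hφ using fun a => hQ.exists_near hnegQ htot (hb a)
  -- Uniqueness of the nearby real turns the arithmetic of `Near` into the homomorphism laws.
  have huniq : ∀ {a r}, Near Q a r → φ a = r := fun {a r} h =>
    le_antisymm ((hφ a).le_of_sub_mem hQ hnegQ h (by simpa using hQ.zero_mem))
      (h.le_of_sub_mem hQ hnegQ (hφ a) (by simpa using hQ.zero_mem))
  have hconst : ∀ r : ℝ, φ (algebraMap ℝ A r) = r := fun r => huniq (Near.const hQ r)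
  refine ⟨{ toFun := φ
            map_one' := by simpa using hconst 1
            map_zero' := by simpa using hconst 0
            map_mul' := fun a b => huniq ((hφ a).mul hQ (hφ b))
            map_add' := fun a b => huniq ((hφ a).add hQ (hφ b))
            commutes' := hconst }, fun a ha => ?_⟩
  have h0 : Near Q (0 : A) 0 := by simpa using Near.const hQ (A := A) 0
  exact h0.le_of_sub_mem hQ hnegQ (hφ a) (by simpa using hMQ ha)

/-- **Putinar's theorem**, infeasibility form: an Archimedean quadratic module of polynomials
that does not contain `-1` is nonnegative at some point. -/
theorem exists_eval_nonneg {τ : Type*} {M : Set (MvPolynomial τ ℝ)} (hM : IsQuadraticModule M)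
    (hvar : ∀ t, X t ∈ hM.bounded) (hneg : -1 ∉ M) :
    ∃ z : τ → ℝ, ∀ p ∈ M, 0 ≤ eval z p := by
  have htop : hM.bounded = ⊤ := by
    rw [← top_le_iff, ← MvPolynomial.adjoin_range_X]
    exact Algebra.adjoin_le (by rintro _ ⟨t, rfl⟩; exact hvar t)
  obtain ⟨φ, hφ⟩ := hM.exists_algHom_nonneg htop hneg
  refine ⟨fun t => φ (X t), fun p hp => ?_⟩
  have : φ p = eval (fun t => φ (X t)) p := by
    conv_lhs => rw [MvPolynomial.aeval_unique φ]
    rw [MvPolynomial.aeval_eq_eval]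
    rfl
  exact this ▸ hφ p hp

end IsQuadraticModule

/-! ### The quadratic module of a system -/

/-- The quadratic module generated by `g` plus the ideal generated by `h`. -/
def quadModule {A ι κ : Type*} [CommRing A] [Fintype ι] [Fintype κ] (g : ι → A) (h : κ → A) :
    Set A :=
  {p | ∃ (lam₀ : A) (lam : ι → A) (phi : κ → A), IsSumSq lam₀ ∧ (∀ i, IsSumSq (lam i)) ∧
    p = lam₀ + ∑ i, lam i * g i + ∑ j, phi j * h j}

section quadModule

variable {A ι κ : Type*} [CommRing A] [Fintype ι] [Fintype κ] (g : ι → A) (h : κ → A)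

theorem isQuadraticModule_quadModule : IsQuadraticModule (quadModule g h) where
  one_mem := ⟨1, 0, 0, .one, fun _ => .zero, by simp⟩
  add_mem := by
    rintro _ _ ⟨a, b, c, ha, hb, rfl⟩ ⟨a', b', c', ha', hb', rfl⟩
    refine ⟨a + a', b + b', c + c', ha.add ha', fun i => (hb i).add (hb' i), ?_⟩
    simp only [Pi.add_apply, add_mul, Finset.sum_add_distrib]
    ring
  mul_self_mul_mem := by
    rintro p _ ⟨a, b, c, ha, hb, rfl⟩
    refine ⟨p * p * a, fun i => p * p * b i, fun j => p * p * c j, (IsSumSq.mul_self p).mul ha,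
      fun i => (IsSumSq.mul_self p).mul (hb i), ?_⟩
    simp only [mul_add, Finset.mul_sum, mul_assoc]

theorem ineq_mem_quadModule (i : ι) : g i ∈ quadModule g h := by
  classical
  refine ⟨0, Pi.single i 1, 0, .zero, fun j => ?_, ?_⟩
  · by_cases hj : j = i
    · subst hj; simp [IsSumSq.one]
    · simp [hj, IsSumSq.zero]
  · simp [Pi.single_apply]

theorem mul_eqn_mem_quadModule (j : κ) (p : A) : p * h j ∈ quadModule g h := by
  classical
  exact ⟨0, 0, Pi.single j p, .zero, fun _ => .zero, by simp [Pi.single_apply]⟩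

end quadModule

/-! ### Farkas' lemma and polyhedra -/

/-- **Farkas' lemma**, for finitely many linear forms on a real vector space. -/
theorem exists_nonneg_combination {V : Type*} [AddCommGroup V] [Module ℝ V] :
    ∀ {m : ℕ} (α : Fin m → V →ₗ[ℝ] ℝ) (γ : V →ₗ[ℝ] ℝ),
      (∀ x, (∀ i, 0 ≤ α i x) → 0 ≤ γ x) →
      ∃ c : Fin m → ℝ, (∀ i, 0 ≤ c i) ∧ ∀ x, γ x = ∑ i, c i * α i x := by
  intro m
  induction m with
  | zero =>
    intro α γ h
    refine ⟨0, fun _ => le_rfl, fun x => ?_⟩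
    have h₁ := h x fun i => i.elim0
    have h₂ := h (-x) fun i => i.elim0
    rw [map_neg] at h₂
    simp only [Finset.univ_eq_empty, Finset.sum_empty]
    linarith
  | succ m ih =>
    intro α γ h
    -- Either the constraint `α 0` is redundant, or some `x₀` violates `γ` while satisfying all the
    -- others, which forces `α 0 x₀ < 0`. Projecting along `x₀` onto the kernel of `α 0` then
    -- removes one constraint.
    by_cases hm : ∀ x, (∀ i : Fin m, 0 ≤ α i.succ x) → 0 ≤ γ x
    · obtain ⟨c, hc, hγ⟩ := ih (fun i => α i.succ) γ hm
      refine ⟨Fin.cons 0 c, fun i => ?_, fun x => ?_⟩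
      · refine Fin.cases ?_ (fun i => ?_) i
        · simp
        · simpa using hc i
      · simp [Fin.sum_univ_succ, hγ x]
    · push Not at hm
      obtain ⟨x₀, hx₀, hγ₀⟩ := hm
      have hneg : α 0 x₀ < 0 := by
        by_contra! h0
        exact absurd (h x₀ fun i => Fin.cases h0 hx₀ i) (not_le.2 hγ₀)
      obtain ⟨c, hc, hγ⟩ := ih (fun i => α i.succ - (α i.succ x₀ / α 0 x₀) • α 0)
        (γ - (γ x₀ / α 0 x₀) • α 0) (by
          intro x hx
          have := h (x - (α 0 x / α 0 x₀) • x₀) (fun i => by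
            refine Fin.cases ?_ (fun i => ?_) i
            · simp [div_mul_cancel₀ _ hneg.ne]
            · have := hx i
              simp only [LinearMap.sub_apply, LinearMap.smul_apply, smul_eq_mul, map_sub,
                map_smul] at this ⊢
              convert this using 2
              ring)
          simp only [LinearMap.sub_apply, LinearMap.smul_apply, smul_eq_mul, map_sub,
            map_smul] at this ⊢
          convert this using 2
          ring)
      -- The coefficient of `α 0` collects what the projection subtracted; the signs at `x₀` make it
      -- nonnegative.
      refine ⟨Fin.cons (γ x₀ / α 0 x₀ - ∑ i, c i * (α i.succ x₀ / α 0 x₀)) c, fun i => ?_,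
        fun x => ?_⟩
      · refine Fin.cases ?_ (fun i => by simpa using hc i) i
        rw [Fin.cons_zero]
        have h₁ : 0 ≤ γ x₀ / α 0 x₀ := div_nonneg_of_nonpos hγ₀.le hneg.le
        have h₂ : ∑ i, c i * (α i.succ x₀ / α 0 x₀) ≤ 0 :=
          Finset.sum_nonpos fun i _ => mul_nonpos_of_nonneg_of_nonpos (hc i)
            (div_nonpos_of_nonneg_of_nonpos (hx₀ i) hneg.le)
        linarith
      · have := hγ x
        simp only [LinearMap.sub_apply, LinearMap.smul_apply, smul_eq_mul, mul_sub,
          Finset.sum_sub_distrib, ← mul_assoc] at this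
        rw [Fin.sum_univ_succ]
        simp only [Fin.cons_zero, Fin.cons_succ, sub_mul, Finset.sum_mul]
        linarith

section polyhedron

variable {N m : ℕ} (K : Matrix (Fin m) (Fin N) ℝ) (d : Fin m → ℝ)

/-- An affine function whose homogenization is nonnegative on the homogenization of a
polyhedron is a nonnegative combination of `1` and the defining affine functions. -/
theorem exists_affine_combination (e : Fin N → ℝ) (b : ℝ)
    (h : ∀ (v : Fin N → ℝ) (t : ℝ), 0 ≤ t → (∀ j, (K *ᵥ v) j ≤ d j * t) → 0 ≤ b * t + e ⬝ᵥ v) :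
    ∃ (c₀ : ℝ) (c : Fin m → ℝ), 0 ≤ c₀ ∧ (∀ j, 0 ≤ c j) ∧
      ∀ v, b + e ⬝ᵥ v = c₀ + ∑ j, c j * (d j - (K *ᵥ v) j) := by
  -- The extra coordinate `t` homogenizes the problem; the constraint `0 ≤ t` contributes the
  -- constant `c₀`, and `t = 1` recovers the affine statement.
  let tf : (Fin N → ℝ) × ℝ →ₗ[ℝ] ℝ := LinearMap.snd ℝ _ _
  let form : (Fin N → ℝ) → (Fin N → ℝ) × ℝ →ₗ[ℝ] ℝ := fun w =>
    (dotProductBilin ℝ ℝ w).comp (LinearMap.fst ℝ (Fin N → ℝ) ℝ)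
  obtain ⟨c, hc, hγ⟩ := exists_nonneg_combination
    (Fin.cons tf fun j => d j • tf - form (K j) : Fin (m + 1) → (Fin N → ℝ) × ℝ →ₗ[ℝ] ℝ)
    (b • tf + form e) (by
      rintro ⟨v, t⟩ hx
      have h0 := hx 0
      refine h v t (by simpa [tf] using h0) fun j => ?_
      have := hx j.succ
      simpa [tf, form, Matrix.mulVec] using this)
  refine ⟨c 0, fun j => c j.succ, hc 0, fun j => hc _, fun v => ?_⟩
  have := hγ (v, 1)
  rw [Fin.sum_univ_succ] at this
  simpa [tf, form, Matrix.mulVec] using this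

variable {σ : Type*} {M : Set (MvPolynomial σ ℝ)}

theorem affine_mem_of_facets_mem (hM : IsQuadraticModule M) (ι : Fin N → σ)
    (hK : ∀ j, C (d j) - ∑ i, C (K j i) * X (ι i) ∈ M) (e : Fin N → ℝ) (b : ℝ)
    (h : ∀ (v : Fin N → ℝ) (t : ℝ), 0 ≤ t → (∀ j, (K *ᵥ v) j ≤ d j * t) → 0 ≤ b * t + e ⬝ᵥ v) :
    C b + ∑ i, C (e i) * X (ι i) ∈ M := by
  obtain ⟨c₀, c, hc₀, hc, heq⟩ := exists_affine_combination K d e b h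
  have hmem := hM.add_mem (hM.algebraMap_mem hc₀)
    (hM.sum_mem (I := Finset.univ) fun j _ => hM.algebraMap_mul_mem (hc j) (hK j))
  convert hmem using 1
  refine MvPolynomial.funext fun z => ?_
  have := heq fun i => z (ι i)
  simpa [dotProduct, Matrix.mulVec, MvPolynomial.algebraMap_eq] using this

/-- A point of the homogenized cone with `t > 0` would rescale into the polyhedron. So the cone lies
in `t = 0`, where the homogenization `-t` of `-1` vanishes. -/
theorem neg_one_mem_of_polyhedron_eq_empty (hM : IsQuadraticModule M) (ι : Fin N → σ)
    (hK : ∀ j, C (d j) - ∑ i, C (K j i) * X (ι i) ∈ M) (hP : polyhedron K d = ∅) :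
    -1 ∈ M := by
  have := affine_mem_of_facets_mem K d hM ι hK 0 (-1) (by
    intro v t ht hv
    rcases ht.eq_or_lt with rfl | ht
    · simp
    · exfalso
      have : t⁻¹ • v ∈ polyhedron K d := by
        intro j
        rw [mulVec_smul, Pi.smul_apply, smul_eq_mul, inv_mul_le_iff₀ ht, mul_comm]
        exact hv j
      rw [hP] at this
      exact this)
  simpa using this

/-- The coordinates are bounded with respect to the quadratic module of a nonempty compact
polyhedron. -/
theorem X_mem_bounded_of_isCompact (hM : IsQuadraticModule M) (ι : Fin N → σ)
    (hK : ∀ j, C (d j) - ∑ i, C (K j i) * X (ι i) ∈ M) (hP : IsCompact (polyhedron K d))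
    (hne : (polyhedron K d).Nonempty) (i : Fin N) : X (ι i) ∈ hM.bounded := by
  classical
  obtain ⟨b, hb⟩ := hP.isBounded.exists_norm_le
  obtain ⟨s₀, hs₀⟩ := hne
  have hcoord : ∀ s ∈ polyhedron K d, |s i| ≤ b := fun s hs =>
    (norm_le_pi_norm s i).trans (hb s hs)
  have key : ∀ (v : Fin N → ℝ) (t : ℝ), 0 ≤ t → (∀ j, (K *ᵥ v) j ≤ d j * t) →
      |v i| ≤ b * t := by
    intro v t ht hv
    rcases ht.eq_or_lt with rfl | ht
    · simp only [mul_zero] at hv ⊢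
      by_contra! hpos
      -- Here `v` is a recession direction. This multiple of it moves coordinate `i` by `2b + 1`,
      -- while two points of the polyhedron differ there by at most `2b`.
      have hmem : s₀ + ((2 * b + 1) / |v i|) • v ∈ polyhedron K d := by
        intro j
        rw [mulVec_add, mulVec_smul, Pi.add_apply, Pi.smul_apply, smul_eq_mul]
        have h₁ := hs₀ j
        have hb0 : 0 ≤ b := (abs_nonneg _).trans (hcoord s₀ hs₀)
        have h₂ : (2 * b + 1) / |v i| * (K *ᵥ v) j ≤ 0 :=
          mul_nonpos_of_nonneg_of_nonpos (by positivity) (hv j)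
        linarith
      have h₁ := hcoord _ hmem
      have h₂ := hcoord _ hs₀
      have hb0 : 0 ≤ b := (abs_nonneg _).trans h₂
      have h₃ : |((2 * b + 1) / |v i|) * v i| = 2 * b + 1 := by
        rw [abs_mul, abs_div, abs_abs, div_mul_cancel₀ _ hpos.ne', abs_of_nonneg (by linarith)]
      rw [Pi.add_apply, Pi.smul_apply, smul_eq_mul] at h₁
      have h₄ := abs_add_le (s₀ i + ((2 * b + 1) / |v i|) * v i) (-s₀ i)
      rw [abs_neg, add_neg_cancel_comm, h₃] at h₄
      linarith
    · have hmem : t⁻¹ • v ∈ polyhedron K d := by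
        intro j
        rw [mulVec_smul, Pi.smul_apply, smul_eq_mul, inv_mul_le_iff₀ ht, mul_comm]
        exact hv j
      have := hcoord _ hmem
      rw [Pi.smul_apply, smul_eq_mul, abs_mul, abs_of_pos (inv_pos.2 ht),
        inv_mul_le_iff₀ ht] at this
      linarith
  have h₁ := affine_mem_of_facets_mem K d hM ι hK (Pi.single i 1) b fun v t ht hv => by
    have := (abs_le.1 (key v t ht hv)).1
    rw [single_one_dotProduct]; linarith
  have h₂ := affine_mem_of_facets_mem K d hM ι hK (-Pi.single i 1) b fun v t ht hv => by
    have := (abs_le.1 (key v t ht hv)).2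
    rw [neg_dotProduct, single_one_dotProduct]; linarith
  refine hM.mem_bounded_of_mem (c := b) ?_ ?_
  · simpa [Pi.single_apply, apply_ite, ite_mul, sub_eq_add_neg, algebraMap_eq] using h₂
  · simpa [Pi.single_apply, apply_ite, ite_mul, algebraMap_eq] using h₁

end polyhedron

/-! ### Rational forward kinematics -/

/-- The rational pose `T` represents the family of rigid poses `P`, with a denominator that
exceeds `1` by a sum of squares. -/
structure RatPose.Represents {N : ℕ} (T : RatPose N) (P : (Fin N → ℝ) → Pose) : Prop where
  den : IsSumSq (T.den - 1)
  rot : ∀ s i j, eval s (T.rotNum i j) = eval s T.den * (P s).rot i j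
  pos : ∀ s i, eval s (T.posNum i) = eval s T.den * (P s).pos i
  orth : ∀ s, (P s).rotᵀ * (P s).rot = 1

/-- Keeps the invariant "denominator minus one is a sum of squares" under composition of poses. -/
theorem isSumSq_mul_sub_one {A : Type*} [CommRing A] {a b : A} (ha : IsSumSq (a - 1))
    (hb : IsSumSq (b - 1)) : IsSumSq (a * b - 1) := by
  have h : a * b - 1 = (a - 1) * (b - 1) + (a - 1) + (b - 1) := by ring
  exact h ▸ ((ha.mul hb).add ha).add hb

theorem isSumSq_of_sub_one {A : Type*} [CommRing A] {a : A} (ha : IsSumSq (a - 1)) :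
    IsSumSq a := by
  simpa using ha.add IsSumSq.one

theorem isSumSq_pow {A : Type*} [CommRing A] {a : A} (ha : IsSumSq a) (n : ℕ) :
    IsSumSq (a ^ n) := by
  induction n with
  | zero => simp
  | succ n ih => rw [pow_succ]; exact ih.mul ha

theorem isSumSq_pow_sub_one {A : Type*} [CommRing A] {a : A} (ha : IsSumSq (a - 1)) (n : ℕ) :
    IsSumSq (a ^ n - 1) := by
  induction n with
  | zero => simp
  | succ n ih => rw [pow_succ]; exact isSumSq_mul_sub_one ih ha

theorem isSumSq_map {A B : Type*} [CommRing A] [CommRing B] (f : A →+* B) {a : A}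
    (ha : IsSumSq a) : IsSumSq (f a) := by
  induction ha with
  | zero => simp
  | sq_add c _ ih => rw [map_add, map_mul]; exact .sq_add _ ih

namespace RatPose.Represents

variable {N : ℕ} {S T : RatPose N} {P Q : (Fin N → ℝ) → Pose}

theorem den_pos (hT : T.Represents P) (s : Fin N → ℝ) : 0 < eval s T.den := by
  have := (isSumSq_map (eval s) hT.den).nonneg
  rw [map_sub, map_one] at this
  linarith

theorem comp (hS : S.Represents P) (hT : T.Represents Q) :
    (S.comp T).Represents fun s => (P s).comp (Q s) where
  den := isSumSq_mul_sub_one hS.den hT.den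
  rot s i j := by
    simp only [RatPose.comp, Pose.comp, Matrix.mul_apply, map_sum, map_mul, hS.rot, hT.rot,
      Finset.mul_sum]
    exact Finset.sum_congr rfl fun _ _ => by ring
  pos s i := by
    simp only [RatPose.comp, Pose.comp, Pi.add_apply, Pi.smul_apply, smul_eq_mul,
      Matrix.mulVec, dotProduct, map_add, map_sum, map_mul, hS.rot, hT.pos, hS.pos, mul_add,
      Finset.mul_sum]
    congr 1
    · exact Finset.sum_congr rfl fun _ _ => by ring
    · ring
  orth s := by
    simp only [Pose.comp, transpose_mul]
    rw [Matrix.mul_assoc, ← Matrix.mul_assoc (P s).rotᵀ, hS.orth, Matrix.one_mul, hT.orth]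

theorem const {T : Pose} (hT : T.IsRigid) : (T.toRat N).Represents fun _ => T where
  den := by simp [Pose.toRat]
  rot s i j := by simp [Pose.toRat]
  pos s i := by simp [Pose.toRat]
  orth _ := by
    have := (Matrix.mem_specialOrthogonalGroup_iff.1 hT).1
    exact (Matrix.mem_orthogonalGroup_iff' (Fin 3) ℝ).1 this

theorem joint (i : Fin N) (k : JointKind) :
    (jointRat i k).Represents fun s => jointPose k (ofTC k (s i)) := by
  cases k with
  | revolute =>
    have hpos : ∀ t : ℝ, 1 + t ^ 2 ≠ 0 := fun t => by positivity
    have hcos : ∀ t : ℝ, (1 + t ^ 2) * Real.cos (2 * Real.arctan t) = 1 - t ^ 2 := by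
      intro t
      rw [Real.cos_two_mul, Real.cos_sq_arctan]
      field_simp [hpos t]
      ring
    have hsin : ∀ t : ℝ, (1 + t ^ 2) * Real.sin (2 * Real.arctan t) = 2 * t := by
      intro t
      rw [Real.sin_two_mul]
      have h := Real.tan_mul_cos (Real.cos_arctan_pos t).ne'
      rw [Real.tan_arctan] at h
      rw [← h, mul_assoc 2, mul_assoc t, ← sq, Real.cos_sq_arctan]
      field_simp [hpos t]
    refine ⟨?_, fun s a b => ?_, fun s a => ?_, fun s => ?_⟩
    · simp [jointRat, sq]
    · fin_cases a <;> fin_cases b <;> simp [jointRat, jointPose, ofTC, hcos, hsin]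
    · simp [jointRat, jointPose]
    · ext a b
      have := Real.sin_sq_add_cos_sq (ofTC .revolute (s i))
      fin_cases a <;> fin_cases b <;>
        simp [jointPose, Matrix.mul_apply, Fin.sum_univ_three] <;> linarith
  | prismatic =>
    refine ⟨?_, fun s a b => ?_, fun s a => ?_, fun s => ?_⟩
    · simp [jointRat]
    · by_cases h : a = b <;> simp [jointRat, jointPose, h]
    · fin_cases a <;> simp [jointRat, jointPose, ofTC]
    · simp [jointPose]

end RatPose.Represents

theorem Chain.represents {N : ℕ} (R : Robot N) (c : Chain N) :
    (c.ratPose R).Represents (c.poseTC R) := by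
  obtain ⟨base, steps, hbase, hsteps⟩ := c
  -- The accumulated pose is generalized, as the left fold changes it at each joint.
  have key : ∀ (l : List (Fin N × Pose)), (∀ st ∈ l, st.2.IsRigid) →
      ∀ (T : RatPose N) (P : (Fin N → ℝ) → Pose), T.Represents P →
      (l.foldl (fun T st => (T.comp (jointRat st.1 (R.kind st.1))).comp (st.2.toRat N))
        T).Represents fun s => l.foldl (fun T st => (T.comp (jointPose (R.kind st.1)
          (ofTC (R.kind st.1) (s st.1)))).comp st.2) (P s) := by
    intro l
    induction l with
    | nil => intro _ T P h; exact h
    | cons st l ih =>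
      intro hl T P h
      exact ih (fun st' h' => hl st' (List.mem_cons_of_mem _ h')) _ _
        ((h.comp (.joint st.1 (R.kind st.1))).comp (.const (hl st List.mem_cons_self)))
  exact key steps hsteps _ _ (.const hbase)

section rigid

variable {T : Pose}

theorem Pose.act_invAct (hT : T.rotᵀ * T.rot = 1) (x : Fin 3 → ℝ) : T.act (T.invAct x) = x := by
  rw [Pose.act, Pose.invAct, mulVec_mulVec, mul_eq_one_comm.1 hT, one_mulVec, sub_add_cancel]

theorem Pose.rot_dotProduct_rot (hT : T.rotᵀ * T.rot = 1) (v w : Fin 3 → ℝ) :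
    (T.rot *ᵥ v) ⬝ᵥ (T.rot *ᵥ w) = v ⬝ᵥ w := by
  rw [dotProduct_mulVec, ← mulVec_transpose, mulVec_mulVec, hT, one_mulVec]

theorem Pose.invAct_dotProduct_invAct (hT : T.rotᵀ * T.rot = 1) (x : Fin 3 → ℝ) :
    T.invAct x ⬝ᵥ T.invAct x = (x - T.pos) ⬝ᵥ (x - T.pos) := by
  rw [Pose.invAct, dotProduct_mulVec, ← mulVec_transpose, mulVec_mulVec, transpose_transpose,
    mul_eq_one_comm.1 hT, one_mulVec]

end rigid

theorem Pose.act_sub_act (T : Pose) (y z : Fin 3 → ℝ) : T.act y - T.act z = T.rot *ᵥ (y - z) := by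
  rw [Pose.act, Pose.act, add_sub_add_right_eq_sub, mulVec_sub]

section encodings

variable {N k : ℕ} (R : Robot N) (c : Chain N)

theorem eval_denom (s : Fin N → ℝ) (w : Fin 3 ⊕ Fin k → ℝ) :
    eval (Sum.elim s w) (denom R c : MvPolynomial (Vars N k) ℝ) = eval s (c.ratPose R).den := by
  rw [denom, eval_rename, Sum.elim_comp_inl]

theorem eval_denom_pos (z : Vars N k → ℝ) : 0 < eval z (denom R c) := by
  rw [denom, eval_rename]
  exact (c.represents R).den_pos _

theorem isSumSq_denom_sub_one : IsSumSq ((denom R c : MvPolynomial (Vars N k) ℝ) - 1) := by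
  simpa [denom] using isSumSq_map (rename (Sum.inl : _ → Vars N k)).toRingHom (c.represents R).den

theorem isSumSq_denom : IsSumSq (denom R c : MvPolynomial (Vars N k) ℝ) :=
  isSumSq_of_sub_one (isSumSq_denom_sub_one R c)

theorem eval_pointNum (v : Fin 3 → ℝ) (i : Fin 3) (z : Vars N k → ℝ) :
    eval z (pointNum R c v i) =
      eval z (denom R c) * (c.poseTC R (z ∘ Sum.inl)).act v i := by
  simp only [pointNum, denom, eval_rename, Matrix.mulVec, dotProduct, map_add, map_sum, map_mul,
    eval_C, (c.represents R).rot, (c.represents R).pos, Pose.act, Pi.add_apply, mul_add,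
    Finset.mul_sum, mul_assoc]

end encodings

/-! ### Solutions of a body's system lie in the body -/

/-- A point of the disc at parameter `μ` between two discs with the same normal lies in their
convex hull. -/
theorem mem_convexHull_disc_union {o₁ o₂ n y : Fin 3 → ℝ} {r₁ r₂ μ : ℝ} (hr₁ : 0 ≤ r₁)
    (hr₂ : 0 ≤ r₂) (hμ₀ : 0 ≤ μ) (hμ₁ : 0 ≤ 1 - μ)
    (hn : (y - (μ • o₁ + (1 - μ) • o₂)) ⬝ᵥ n = 0)
    (hy : (y - (μ • o₁ + (1 - μ) • o₂)) ⬝ᵥ (y - (μ • o₁ + (1 - μ) • o₂)) ≤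
      (μ * r₁ + (1 - μ) * r₂) ^ 2) :
    y ∈ convexHull ℝ (disc o₁ n r₁ ∪ disc o₂ n r₂) := by
  obtain ⟨w, hw⟩ : ∃ w, w = y - (μ • o₁ + (1 - μ) • o₂) := ⟨_, rfl⟩
  rw [← hw] at hn hy
  have hrμ : 0 ≤ μ * r₁ + (1 - μ) * r₂ := by positivity
  -- The offset is `r_μ` times a vector `v` of length at most one, so the point is the
  -- `μ`-combination of `o₁ + r₁v` and `o₂ + r₂v`. When `r_μ = 0` the offset vanishes and `v = 0`
  -- serves.
  obtain ⟨v, hwv, hvn, hv⟩ : ∃ v : Fin 3 → ℝ, w = (μ * r₁ + (1 - μ) * r₂) • v ∧ v ⬝ᵥ n = 0 ∧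
      v ⬝ᵥ v ≤ 1 := by
    rcases hrμ.eq_or_lt with h0 | hpos
    · have : w ⬝ᵥ w = 0 := le_antisymm (by simpa [← h0] using hy) (by
        simpa using dotProduct_star_self_nonneg w)
      exact ⟨0, by simpa using dotProduct_self_eq_zero.1 this, by simp, by simp⟩
    · refine ⟨(μ * r₁ + (1 - μ) * r₂)⁻¹ • w, ?_, ?_, ?_⟩
      · rw [smul_smul, mul_inv_cancel₀ hpos.ne', one_smul]
      · rw [smul_dotProduct, hn, smul_zero]
      · rw [smul_dotProduct, dotProduct_smul, smul_eq_mul, smul_eq_mul, ← mul_assoc, ← sq,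
          inv_pow, inv_mul_le_iff₀ (by positivity), mul_one]
        exact hy
  have hdisc : ∀ (o : Fin 3 → ℝ) (r : ℝ), o + r • v ∈ disc o n r := by
    intro o r
    refine ⟨?_, ?_⟩
    · rw [add_sub_cancel_left, smul_dotProduct, hvn, smul_zero]
    · rw [add_sub_cancel_left, smul_dotProduct, dotProduct_smul, smul_eq_mul, smul_eq_mul,
        ← mul_assoc, ← sq]
      exact mul_le_of_le_one_right (sq_nonneg r) hv
  have hcomb := (convex_convexHull ℝ (disc o₁ n r₁ ∪ disc o₂ n r₂))
    (subset_convexHull ℝ _ (Or.inl (hdisc o₁ r₁))) (subset_convexHull ℝ _ (Or.inr (hdisc o₂ r₂)))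
    hμ₀ hμ₁ (by ring)
  convert hcomb using 1
  have : y = w + (μ • o₁ + (1 - μ) • o₂) := by rw [hw, sub_add_cancel]
  rw [this, hwv]
  module

/-- A zero normal imposes no condition, so capsules reduce to the lemma on discs. -/
theorem disc_zero (o : Fin 3 → ℝ) (r : ℝ) : disc o 0 r = ball o r := by
  simp [disc, ball]

theorem Pose.act_combination (T : Pose) (y z : Fin 3 → ℝ) (μ : ℝ) :
    T.act (μ • y + (1 - μ) • z) = μ • T.act y + (1 - μ) • T.act z := by
  simp only [Pose.act, mulVec_add, mulVec_smul]
  module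

/-- The point `x` of a solution lies in the region occupied by the body at the TC-space point
`s` of the solution. -/
theorem Encodes.mem_image_act {N k : ℕ} {R : Robot N} {c : Chain N} {B : Set (Fin 3 → ℝ)}
    {D : PolySystem (Vars N k)} (hE : Encodes R c B k D) {z : Vars N k → ℝ}
    (hz : z ∈ D.solutions) :
    (fun a => z (Sum.inr (Sum.inl a))) ∈ (c.poseTC R fun i => z (Sum.inl i)).act '' B := by
  have hg := eval_denom_pos R c z
  have hrot := (c.represents R).orth fun i => z (Sum.inl i)
  have hpt := fun v a => eval_pointNum R c v a z
  have hs : z ∘ Sum.inl = fun i => z (Sum.inl i) := rfl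
  rw [hs] at hpt
  set T := c.poseTC R fun i => z (Sum.inl i) with hT
  obtain ⟨x, hx⟩ : ∃ x : Fin 3 → ℝ, x = fun a => z (Sum.inr (Sum.inl a)) := ⟨_, rfl⟩
  have hxa : ∀ a, z (Sum.inr (Sum.inl a)) = x a := fun a => by rw [hx]
  rw [← hx]
  have hsub : ∀ y, x - T.act y = T.rot *ᵥ (T.invAct x - y) := fun y => by
    rw [← Pose.act_sub_act, Pose.act_invAct hrot]
  cases hE with
  | polytope v =>
    obtain ⟨hineq, heqn⟩ := hz
    set μ : Fin k → ℝ := fun i => z (Sum.inr (Sum.inr i)) with hμ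
    have hμ₀ : ∀ i, 0 ≤ μ i := fun i => by simpa [polytopeSystem, uVar] using hineq i
    have hμ₁ : ∑ i, μ i = 1 := by
      have := heqn (3 : Fin 4)
      simp only [polytopeSystem, uVar, cons_val, map_sub, map_one, map_sum, eval_X] at this
      simp only [hμ]; linarith
    have hcoord : ∀ a, x a = ∑ i, μ i * T.act (v i) a := by
      have key : ∀ a : Fin 3, eval z ((∏ _i : Fin k, denom R c) * xVar a -
          ∑ i : Fin k, uVar i * (∏ _l ∈ Finset.univ.erase i, denom R c) *
            pointNum R c (v i) a) = 0 := by
        intro a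
        fin_cases a
        · exact heqn (0 : Fin 4)
        · exact heqn (1 : Fin 4)
        · exact heqn (2 : Fin 4)
      intro a
      have h := key a
      simp only [map_sub, map_mul, map_sum, map_prod, xVar, uVar, eval_X, hpt, hxa] at h
      -- The factor `g` in `f^{v_i}` restores the one omitted from the product, so `g^k` factors out
      -- of the whole equation.
      have hterm : ∀ i : Fin k, z (Sum.inr (Sum.inr i)) *
          (∏ _l ∈ Finset.univ.erase i, eval z (denom R c)) *
            (eval z (denom R c) * T.act (v i) a) =
          (∏ _i : Fin k, eval z (denom R c)) * (μ i * T.act (v i) a) := by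
        intro i
        rw [← Finset.mul_prod_erase Finset.univ (fun _ => eval z (denom R c)) (Finset.mem_univ i)]
        ring
      rw [Finset.sum_congr rfl fun i _ => hterm i, ← Finset.mul_sum, ← mul_sub] at h
      have hprod : (∏ _i : Fin k, eval z (denom R c)) ≠ 0 :=
        Finset.prod_ne_zero_iff.2 fun _ _ => hg.ne'
      exact sub_eq_zero.1 ((mul_eq_zero.1 h).resolve_left hprod)
    refine ⟨∑ i, μ i • v i, ?_, ?_⟩
    · exact (convex_convexHull ℝ _).sum_mem (fun i _ => hμ₀ i) hμ₁
        fun i _ => subset_convexHull ℝ _ ⟨i, rfl⟩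
    · funext a
      rw [hcoord a]
      simp only [Pose.act, mulVec_sum, mulVec_smul, Pi.add_apply, Finset.sum_apply,
        Pi.smul_apply, smul_eq_mul, mul_add, Finset.sum_add_distrib, ← Finset.sum_mul, hμ₁,
        one_mul]
  | sphere o r hr =>
    refine ⟨T.invAct x, ?_, Pose.act_invAct hrot x⟩
    have h := hz.1 (0 : Fin 1)
    simp only [sphereSystem, cons_val_zero, map_sub, map_mul, map_pow, map_sum, eval_C, xVar,
      eval_X, hpt, hxa, ← mul_sub, mul_pow, ← Finset.mul_sum] at h
    have h' := nonneg_of_mul_nonneg_right h (by positivity)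
    show (T.invAct x - o) ⬝ᵥ (T.invAct x - o) ≤ r ^ 2
    rw [← Pose.rot_dotProduct_rot hrot, ← hsub]
    simp only [dotProduct, Pi.sub_apply, ← sq]
    linarith
  | capsule o₁ o₂ r₁ r₂ hr₁ hr₂ =>
    refine ⟨T.invAct x, ?_, Pose.act_invAct hrot x⟩
    have h₀ := hz.1 (0 : Fin 3)
    have h₁ := hz.1 (1 : Fin 3)
    have h₂ := hz.1 (2 : Fin 3)
    simp only [capsuleSystem, cons_val, map_sub, map_one, uVar, eval_X] at h₁ h₂
    simp only [capsuleSystem, cons_val_zero, map_sub, map_add, map_one, map_mul, map_pow, map_sum,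
      eval_C, xVar, uVar, eval_X, hpt, hxa] at h₀
    set μ := z (Sum.inr (Sum.inr 0))
    have h₃ : 0 ≤ eval z (denom R c) ^ 2 * ((μ * r₁ + (1 - μ) * r₂) ^ 2 -
        (x - T.act (μ • o₁ + (1 - μ) • o₂)) ⬝ᵥ (x - T.act (μ • o₁ + (1 - μ) • o₂))) := by
      convert h₀ using 1
      rw [Pose.act_combination]
      simp only [dotProduct, Pi.sub_apply, Pi.add_apply, Pi.smul_apply, smul_eq_mul,
        Fin.sum_univ_three]
      ring
    have h₄ := nonneg_of_mul_nonneg_right h₃ (by positivity)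
    rw [hsub, Pose.rot_dotProduct_rot hrot] at h₄
    rw [← disc_zero, ← disc_zero]
    exact mem_convexHull_disc_union hr₁ hr₂ h₁ h₂ (dotProduct_zero _) (by linarith)
  | cylinder o₁ o₂ r₁ r₂ ho hr₁ hr₂ =>
    refine ⟨T.invAct x, ?_, Pose.act_invAct hrot x⟩
    obtain ⟨hineq, heqn⟩ := hz
    have h₀ := hineq (0 : Fin 3)
    have h₁ := hineq (1 : Fin 3)
    have h₂ := hineq (2 : Fin 3)
    have h₃ := heqn (0 : Fin 4)
    simp only [cylinderSystem, cons_val, map_sub, map_one, uVar, eval_X] at h₁ h₂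
    simp only [cylinderSystem, cons_val_zero, map_sub, map_add, map_one, map_mul, map_pow,
      map_sum, eval_C, uVar, eval_X] at h₀
    simp only [cylinderSystem, cons_val_zero, map_sub, map_mul, map_sum, uVar, eval_X,
      hpt] at h₃
    set μ := z (Sum.inr (Sum.inr 0))
    -- After division by `g`, the vector equation identifies `v` with the offset of `x` from the
    -- moved axis point.
    have hv : ∀ a : Fin 3, z (Sum.inr (Sum.inr a.succ)) =
        (x - T.act (μ • o₁ + (1 - μ) • o₂)) a := by
      have key : ∀ a : Fin 3, eval z (denom R c * xVar a - (uVar 0 * pointNum R c o₁ a +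
          (1 - uVar 0) * pointNum R c o₂ a) - denom R c * uVar a.succ) = 0 := by
        intro a
        fin_cases a
        · exact heqn (1 : Fin 4)
        · exact heqn (2 : Fin 4)
        · exact heqn (3 : Fin 4)
      intro a
      have h := key a
      simp only [map_sub, map_add, map_one, map_mul, xVar, uVar, eval_X, hpt, hxa] at h
      rw [Pose.act_combination]
      simp only [Pi.sub_apply, Pi.add_apply, Pi.smul_apply, smul_eq_mul]
      refine mul_left_cancel₀ hg.ne' ?_
      linear_combination -h
    have h₅ : (x - T.act (μ • o₁ + (1 - μ) • o₂)) ⬝ᵥ (T.act o₁ - T.act o₂) = 0 := by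
      refine (mul_eq_zero.1 ?_).resolve_left hg.ne'
      rw [← h₃, dotProduct, Finset.mul_sum]
      refine Finset.sum_congr rfl fun a _ => ?_
      rw [hv a, Pi.sub_apply (T.act o₁)]
      ring
    rw [hsub, Pose.act_sub_act, Pose.rot_dotProduct_rot hrot] at h₅
    refine mem_convexHull_disc_union hr₁ hr₂ h₁ h₂ h₅ ?_
    rw [← Pose.rot_dotProduct_rot hrot, ← hsub]
    simp only [hv] at h₀
    simp only [dotProduct, ← sq]
    linarith
  | semialgebraic E harch hconv ineq' eqn' hineq heqn =>
    refine ⟨T.invAct x, ⟨fun j => z (Sum.inr (Sum.inr j)), ?_, ?_⟩, Pose.act_invAct hrot x⟩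
    all_goals
      have hz' : z = Sum.elim (fun i => z (Sum.inl i))
          (Sum.elim x fun j => z (Sum.inr (Sum.inr j))) := by
        funext t
        rcases t with i | a | j
        · rfl
        · exact hxa a
        · rfl
      have hpos := (c.represents R).den_pos fun i => z (Sum.inl i)
    · intro i
      obtain ⟨e, he⟩ := hineq i
      have h := hz.1 i
      rw [hz'] at h
      simp only [he] at h
      exact nonneg_of_mul_nonneg_right h (by positivity)
    · intro j
      obtain ⟨e, he⟩ := heqn j
      have h := hz.2 j
      rw [hz'] at h
      simp only [he] at h
      exact (mul_eq_zero.1 h).resolve_left (by positivity)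

/-! ### The variables of a body's system are bounded -/

/-- Applied to the bounded elements, it bounds every polynomial in `s`, notably `g` and `f^v`. -/
theorem rename_mem_of_X_mem {σ τ : Type*} (S : Subalgebra ℝ (MvPolynomial τ ℝ)) (ι : σ → τ)
    (hS : ∀ i, X (ι i) ∈ S) (p : MvPolynomial σ ℝ) : rename ι p ∈ S := by
  induction p using MvPolynomial.induction_on with
  | C r => rw [rename_C]; exact S.algebraMap_mem r
  | add p q hp hq => rw [map_add]; exact S.add_mem hp hq
  | mul_X p i hp => rw [map_mul, rename_X]; exact S.mul_mem hp (hS i)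

theorem IsQuadraticModule.mem_bounded_of_mul_mem {A : Type*} [CommRing A] [Algebra ℝ A]
    {M : Set A} (hM : IsQuadraticModule M) {a : A} (ha : ∀ p, p * a ∈ M) : a ∈ hM.bounded :=
  ⟨0, by simpa [sq] using ha (-a)⟩

theorem IsQuadraticModule.mem_bounded_of_mem_Icc {A : Type*} [CommRing A] [Algebra ℝ A]
    {M : Set A} (hM : IsQuadraticModule M) {a : A} (h₀ : a ∈ M) (h₁ : 1 - a ∈ M) :
    a ∈ hM.bounded :=
  hM.mem_bounded_of_mem (c := 1) (by simpa using h₁) (by simpa using hM.add_mem hM.one_mem h₀)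

section cleared

variable {N k : ℕ} {R : Robot N} {c : Chain N}

/-- `p'` is `den ^ e` times the polynomial `p` in the coordinates of the moving frame. -/
def ClearedBy (R : Robot N) (c : Chain N) (e : ℕ) (p : MvPolynomial (Fin 3 ⊕ Fin k) ℝ)
    (p' : MvPolynomial (Vars N k) ℝ) : Prop :=
  ∀ (s : Fin N → ℝ) (x : Fin 3 → ℝ) (u : Fin k → ℝ),
    eval (Sum.elim s (Sum.elim x u)) p' =
      eval s (c.ratPose R).den ^ e * eval (Sum.elim ((c.poseTC R s).invAct x) u) p

variable {e f : ℕ} {p q : MvPolynomial (Fin 3 ⊕ Fin k) ℝ} {p' q' : MvPolynomial (Vars N k) ℝ}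

theorem ClearedBy.pow_mul (hp : ClearedBy R c e p p') (f : ℕ) :
    ClearedBy R c (f + e) p (denom R c ^ f * p') := by
  intro s x u
  rw [map_mul, map_pow, eval_denom, hp, pow_add, mul_assoc]

theorem ClearedBy.add (hp : ClearedBy R c e p p') (hq : ClearedBy R c e q q') :
    ClearedBy R c e (p + q) (p' + q') := by
  intro s x u
  rw [map_add, map_add, hp, hq, mul_add]

theorem ClearedBy.mul (hp : ClearedBy R c e p p') (hq : ClearedBy R c f q q') :
    ClearedBy R c (e + f) (p * q) (p' * q') := by
  intro s x u
  rw [map_mul, map_mul, hp, hq]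
  ring

theorem exists_clearedBy (R : Robot N) (c : Chain N) (p : MvPolynomial (Fin 3 ⊕ Fin k) ℝ) :
    ∃ (e : ℕ) (p' : MvPolynomial (Vars N k) ℝ), ClearedBy R c e p p' := by
  induction p using MvPolynomial.induction_on with
  | C r => exact ⟨0, C r, fun s x u => by simp⟩
  | add p q hp hq =>
    obtain ⟨e, p', hp⟩ := hp
    obtain ⟨f, q', hq⟩ := hq
    exact ⟨f + e, _, (hp.pow_mul f).add (add_comm e f ▸ hq.pow_mul e)⟩
  | mul_X p t hp =>
    obtain ⟨e, p', hp⟩ := hp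
    suffices ∃ (f : ℕ) (q' : MvPolynomial (Vars N k) ℝ), ClearedBy R c f (X t) q' by
      obtain ⟨f, q', hq⟩ := this
      exact ⟨e + f, _, hp.mul hq⟩
    rcases t with a | j
    -- Exponent 2: the rotation entry and the position each contribute one denominator.
    · refine ⟨2, ∑ b, rename Sum.inl ((c.ratPose R).rotNum b a) *
        (denom R c * xVar b - rename Sum.inl ((c.ratPose R).posNum b)), fun s x u => ?_⟩
      simp only [map_sum, map_mul, map_sub, eval_rename, Sum.elim_comp_inl, eval_denom,
        (c.represents R).rot, (c.represents R).pos, xVar, eval_X, Sum.elim_inl, Sum.elim_inr,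
        Pose.invAct, mulVec, dotProduct, transpose_apply, Pi.sub_apply, Finset.mul_sum]
      exact Finset.sum_congr rfl fun b _ => by ring
    · exact ⟨0, uVar j, fun s x u => by simp [uVar]⟩

/-- The polynomials in the coordinates of the moving frame that lie in `M` after clearing
denominators form a quadratic module. -/
theorem isQuadraticModule_cleared {M : Set (MvPolynomial (Vars N k) ℝ)}
    (hM : IsQuadraticModule M) :
    IsQuadraticModule {p | ∃ e, ∃ p' ∈ M, ClearedBy R c e p p'} where
  one_mem := ⟨0, 1, hM.one_mem, fun s x u => by simp⟩
  add_mem := by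
    rintro p q ⟨e, p', hpM, hp⟩ ⟨f, q', hqM, hq⟩
    -- Exponents are equalized by powers of `g`, which are sums of squares and so preserve
    -- membership in `M`.
    exact ⟨f + e, _, hM.add_mem (hM.sumSq_mul_mem (isSumSq_pow (isSumSq_denom R c) f) hpM)
      (hM.sumSq_mul_mem (isSumSq_pow (isSumSq_denom R c) e) hqM),
      (hp.pow_mul f).add (add_comm e f ▸ hq.pow_mul e)⟩
  mul_self_mul_mem := by
    rintro a p ⟨e, p', hpM, hp⟩
    obtain ⟨f, a', ha⟩ := exists_clearedBy R c a
    exact ⟨_, _, hM.mul_self_mul_mem a' hpM, (ha.mul ha).mul hp⟩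

/-- Orthogonality turns `‖y‖²` into `‖x - pos‖²`. Multiplication by `g^(e+2)` makes the total
exponent of `g` the even number `2e + 2`, so the cleared certificate is a polynomial in `s` minus
squares. Each squared term is therefore bounded, and its powers of `g` cancel. -/
theorem IsQuadraticModule.bounded_of_cleared {M : Set (MvPolynomial (Vars N k) ℝ)}
    (hM : IsQuadraticModule M) (hs : ∀ i, X (Sum.inl i) ∈ hM.bounded) {n : ℝ}
    (hp' : p' ∈ M) (hp : ClearedBy R c e (C n - ∑ t, X t ^ 2) p') :
    (∀ a, xVar a ∈ hM.bounded) ∧ ∀ j, uVar j ∈ hM.bounded := by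
  have hden : (denom R c : MvPolynomial (Vars N k) ℝ) ∈ hM.bounded :=
    rename_mem_of_X_mem _ _ hs _
  have hone := isSumSq_denom_sub_one (k := k) R c
  let F : Fin 3 ⊕ Fin k → MvPolynomial (Vars N k) ℝ :=
    Sum.elim (fun a => denom R c ^ e * (denom R c * xVar a -
      rename Sum.inl ((c.ratPose R).posNum a))) fun j => denom R c ^ (e + 1) * uVar j
  have hmem : C n * denom R c ^ (2 * e + 2) - ∑ t, F t ^ 2 ∈ M := by
    have h := hM.sumSq_mul_mem (isSumSq_pow (isSumSq_denom R c) (e + 2)) hp'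
    convert h using 1
    refine MvPolynomial.funext fun z => ?_
    obtain ⟨s, x, u, rfl⟩ : ∃ s x u, z = Sum.elim s (Sum.elim x u) :=
      ⟨z ∘ Sum.inl, (z ∘ Sum.inr) ∘ Sum.inl, (z ∘ Sum.inr) ∘ Sum.inr, by simp⟩
    rw [hp.pow_mul (e + 2) s x u]
    have hdot := Pose.invAct_dotProduct_invAct ((c.represents R).orth s) x
    simp only [dotProduct, Pi.sub_apply, ← sq] at hdot
    simp only [F, Fintype.sum_sum_type, Sum.elim_inl, Sum.elim_inr, map_sub, map_add, map_sum,
      map_mul, map_pow, eval_C, eval_X, eval_denom, eval_rename, Sum.elim_comp_inl, xVar, uVar,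
      (c.represents R).pos, hdot, ← mul_sub, mul_pow, ← Finset.mul_sum]
    ring
  have hF : ∀ t, F t ∈ hM.bounded := fun t =>
    hM.mem_bounded_of_sub_sum_sq_mem
      (hM.bounded.mul_mem (hM.bounded.algebraMap_mem n) (pow_mem hden _)) hmem (Finset.mem_univ t)
  refine ⟨fun a => ?_, fun j => ?_⟩
  · have h := hM.mem_bounded_of_mul_mem_bounded (isSumSq_pow_sub_one hone _) (hF (Sum.inl a))
    refine hM.mem_bounded_of_mul_mem_bounded hone ?_
    simpa using hM.bounded.add_mem h
      (rename_mem_of_X_mem hM.bounded (Sum.inl : _ → Vars N k) hs ((c.ratPose R).posNum a))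
  · exact hM.mem_bounded_of_mul_mem_bounded (isSumSq_pow_sub_one hone _) (hF (Sum.inr j))

end cleared

/-- A quadratic module that contains the system of a body and bounds the TC-space variables is
Archimedean. -/
theorem Encodes.X_mem_bounded {N k : ℕ} {R : Robot N} {c : Chain N} {B : Set (Fin 3 → ℝ)}
    {D : PolySystem (Vars N k)} (hE : Encodes R c B k D) {M : Set (MvPolynomial (Vars N k) ℝ)}
    (hM : IsQuadraticModule M) (hineq : ∀ i, D.ineq i ∈ M) (heqn : ∀ j p, p * D.eqn j ∈ M)
    (hs : ∀ i, X (Sum.inl i) ∈ hM.bounded) (t : Vars N k) : X t ∈ hM.bounded := by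
  suffices h : (∀ a, xVar a ∈ hM.bounded) ∧ ∀ j, uVar j ∈ hM.bounded by
    rcases t with i | a | j
    exacts [hs i, h.1 a, h.2 j]
  have hden : (denom R c : MvPolynomial (Vars N k) ℝ) ∈ hM.bounded :=
    rename_mem_of_X_mem _ _ hs _
  have hpt : ∀ v a, (pointNum R c v a : MvPolynomial (Vars N k) ℝ) ∈ hM.bounded :=
    fun v a => rename_mem_of_X_mem _ _ hs _
  have hone := isSumSq_denom_sub_one (k := k) R c
  have hx : ∀ a, denom R c * xVar a ∈ hM.bounded → xVar a ∈ hM.bounded := fun a h =>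
    hM.mem_bounded_of_mul_mem_bounded hone h
  cases hE with
  | polytope v =>
    have hu : ∀ j, uVar j ∈ hM.bounded := by
      intro j
      refine hM.mem_bounded_of_mem_Icc (hineq j) ?_
      have h : 1 - ∑ i, uVar i ∈ M := by simpa [polytopeSystem] using heqn (3 : Fin 4) 1
      -- `1 - μ_j = (1 - ∑ μ_i) + ∑_{i ≠ j} μ_i`.
      convert hM.add_mem h (hM.sum_mem (I := Finset.univ.erase j) fun i _ => hineq i) using 1
      rw [← Finset.add_sum_erase Finset.univ _ (Finset.mem_univ j)]
      simp only [polytopeSystem]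
      ring
    refine ⟨fun a => ?_, hu⟩
    have hprod : IsSumSq ((∏ _i : Fin k, (denom R c : MvPolynomial (Vars N k) ℝ)) - 1) := by
      simpa using isSumSq_pow_sub_one hone k
    refine hM.mem_bounded_of_mul_mem_bounded hprod ?_
    have h : (∏ _i : Fin k, denom R c) * xVar a - ∑ i : Fin k, uVar i *
        (∏ _l ∈ Finset.univ.erase i, denom R c) * pointNum R c (v i) a ∈ hM.bounded := by
      fin_cases a
      · exact hM.mem_bounded_of_mul_mem (heqn (0 : Fin 4))
      · exact hM.mem_bounded_of_mul_mem (heqn (1 : Fin 4))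
      · exact hM.mem_bounded_of_mul_mem (heqn (2 : Fin 4))
    have h' : ∑ i : Fin k, uVar i * (∏ _l ∈ Finset.univ.erase i, denom R c) *
        pointNum R c (v i) a ∈ hM.bounded :=
      sum_mem fun i _ => mul_mem (mul_mem (hu i) (prod_mem fun _ _ => hden)) (hpt _ _)
    simpa using add_mem h h'
  | sphere o r hr =>
    refine ⟨fun a => hx a ?_, fun j => j.elim0⟩
    have hb : denom R c ^ 2 * C (r ^ 2) ∈ hM.bounded :=
      mul_mem (pow_mem hden 2) (hM.bounded.algebraMap_mem _)
    -- The inequality is a bounded polynomial in `s` minus the squares of the `g x_a - f^o_a`.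
    have h := hM.mem_bounded_of_sub_sum_sq_mem hb (hineq (0 : Fin 1)) (Finset.mem_univ a)
    simpa using add_mem h (hpt o a)
  | capsule o₁ o₂ r₁ r₂ hr₁ hr₂ =>
    have hu : uVar 0 ∈ hM.bounded := hM.mem_bounded_of_mem_Icc (hineq (1 : Fin 3)) (hineq (2 : Fin 3))
    refine ⟨fun a => hx a ?_, fun j => Subsingleton.elim 0 j ▸ hu⟩
    have hu' : 1 - uVar 0 ∈ hM.bounded := sub_mem (one_mem _) hu
    have hb : denom R c ^ 2 * (uVar 0 * C r₁ + (1 - uVar 0) * C r₂) ^ 2 ∈ hM.bounded :=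
      mul_mem (pow_mem hden 2) (pow_mem (add_mem (mul_mem hu (hM.bounded.algebraMap_mem r₁))
        (mul_mem hu' (hM.bounded.algebraMap_mem r₂))) 2)
    have h := hM.mem_bounded_of_sub_sum_sq_mem hb (hineq (0 : Fin 3)) (Finset.mem_univ a)
    simpa using add_mem h (add_mem (mul_mem hu (hpt o₁ a)) (mul_mem hu' (hpt o₂ a)))
  | cylinder o₁ o₂ r₁ r₂ ho hr₁ hr₂ =>
    have hu : uVar 0 ∈ hM.bounded := hM.mem_bounded_of_mem_Icc (hineq (1 : Fin 3)) (hineq (2 : Fin 3))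
    have hu' : 1 - uVar 0 ∈ hM.bounded := sub_mem (one_mem _) hu
    have hb : (uVar 0 * C r₁ + (1 - uVar 0) * C r₂) ^ 2 ∈ hM.bounded :=
      pow_mem (add_mem (mul_mem hu (hM.bounded.algebraMap_mem r₁))
        (mul_mem hu' (hM.bounded.algebraMap_mem r₂))) 2
    have hv : ∀ a : Fin 3, uVar a.succ ∈ hM.bounded := fun a =>
      hM.mem_bounded_of_sub_sum_sq_mem hb (hineq (0 : Fin 3)) (Finset.mem_univ a)
    refine ⟨fun a => hx a ?_, Fin.cases hu hv⟩
    have h : denom R c * xVar a - (uVar 0 * pointNum R c o₁ a + (1 - uVar 0) * pointNum R c o₂ a) -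
        denom R c * uVar a.succ ∈ hM.bounded := by
      fin_cases a
      · exact hM.mem_bounded_of_mul_mem (heqn (1 : Fin 4))
      · exact hM.mem_bounded_of_mul_mem (heqn (2 : Fin 4))
      · exact hM.mem_bounded_of_mul_mem (heqn (3 : Fin 4))
    simpa using add_mem (add_mem h (mul_mem hden (hv a)))
      (add_mem (mul_mem hu (hpt o₁ a)) (mul_mem hu' (hpt o₂ a)))
  | semialgebraic E harch hconv ineq' eqn' hineq' heqn' =>
    have hQ := isQuadraticModule_cleared (R := R) (c := c) hM
    obtain ⟨n, lam₀, lam, phi, h₀, hlam, heq⟩ := harch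
    -- The Archimedean identity is transported term by term; the arbitrary multiplier of an equation
    -- is cleared as well and absorbed by the ideal.
    have hmem : C (n : ℝ) - ∑ t, X t ^ 2 ∈
        {p | ∃ e, ∃ p' ∈ M, ClearedBy R c e p p'} := by
      rw [heq]
      refine hQ.add_mem (hQ.add_mem (hQ.sumSq_mem h₀) (hQ.sum_mem fun i _ =>
        hQ.sumSq_mul_mem (hlam i) ?_)) (hQ.sum_mem fun j _ => ?_)
      · obtain ⟨e, he⟩ := hineq' i
        exact ⟨e, _, hineq i, he⟩
      · obtain ⟨e, he⟩ := heqn' j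
        obtain ⟨f, q, hq⟩ := exists_clearedBy R c (phi j)
        exact ⟨f + e, _, heqn j q, hq.mul he⟩
    obtain ⟨e, p', hp', hp⟩ := hmem
    exact hM.bounded_of_cleared hs hp' hp

/-! ### Feasibility of the program -/

section program

variable {N m : ℕ} {R : Robot N} {K : Matrix (Fin m) (Fin N) ℝ} {d : Fin m → ℝ} {A B : Body R}

theorem ProgramFeasible.mono {ρ ρ' : ℕ} (h : ProgramFeasible K d A B ρ) (hρ : ρ ≤ ρ') :
    ProgramFeasible K d A B ρ' := by
  obtain ⟨l₀, lP, lA, pA, lB, pB, hsos, ⟨h₀, hP, hA, hpA, hB, hpB⟩, heq⟩ := h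
  exact ⟨l₀, lP, lA, pA, lB, pB, hsos, ⟨h₀.trans hρ, fun j => (hP j).trans hρ,
    fun j => (hA j).trans hρ, fun j => (hpA j).trans hρ, fun j => (hB j).trans hρ,
    fun j => (hpB j).trans hρ⟩, heq⟩

/-- The inequalities of the program for a pair of bodies. -/
noncomputable def pairIneq (K : Matrix (Fin m) (Fin N) ℝ) (d : Fin m → ℝ) (A B : Body R) :
    Fin m ⊕ (Fin A.system.numIneq ⊕ Fin B.system.numIneq) →
      MvPolynomial (PairVars N A.aux B.aux) ℝ :=
  Sum.elim (facet K d) (Sum.elim (fun i => rename inclA (A.system.ineq i))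
    fun i => rename inclB (B.system.ineq i))

/-- The equations of the program for a pair of bodies. -/
noncomputable def pairEqn (A B : Body R) : Fin A.system.numEq ⊕ Fin B.system.numEq →
    MvPolynomial (PairVars N A.aux B.aux) ℝ :=
  Sum.elim (fun j => rename inclA (A.system.eqn j)) fun j => rename inclB (B.system.eqn j)

/-- A certificate of some degree exists when `-1` lies in the quadratic module of the pair. -/
theorem exists_programFeasible (h : -1 ∈ quadModule (pairIneq K d A B) (pairEqn A B)) :
    ∃ ρ, ProgramFeasible K d A B ρ := by
  obtain ⟨l₀, l, p, hl₀, hl, heq⟩ := h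
  refine ⟨l₀.totalDegree + ∑ i, (l i).totalDegree + ∑ j, (p j).totalDegree,
    l₀, fun j => l (.inl j), fun i => l (.inr (.inl i)), fun j => p (.inl j),
    fun i => l (.inr (.inr i)), fun j => p (.inr j),
    ⟨hl₀, fun _ => hl _, fun _ => hl _, fun _ => hl _⟩, ?_, ?_⟩
  · have hli : ∀ i, (l i).totalDegree ≤
        l₀.totalDegree + ∑ i, (l i).totalDegree + ∑ j, (p j).totalDegree := fun i =>
      ((Finset.single_le_sum (f := fun i => (l i).totalDegree) (fun _ _ => Nat.zero_le _)
        (Finset.mem_univ i)).trans (Nat.le_add_left _ _)).trans (Nat.le_add_right _ _)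
    have hpj : ∀ j, (p j).totalDegree ≤
        l₀.totalDegree + ∑ i, (l i).totalDegree + ∑ j, (p j).totalDegree := fun j =>
      (Finset.single_le_sum (f := fun j => (p j).totalDegree) (fun _ _ => Nat.zero_le _)
        (Finset.mem_univ j)).trans (Nat.le_add_left _ _)
    exact ⟨by omega, fun _ => hli _, fun _ => hli _, fun _ => hpj _, fun _ => hli _,
      fun _ => hpj _⟩
  · rw [heq]
    simp only [Fintype.sum_sum_type, pairIneq, pairEqn, Sum.elim_inl, Sum.elim_inr]
    ring

/-- The quadratic module of a pair of bodies that do not collide over a compact polyhedron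
contains `-1`. -/
theorem neg_one_mem_quadModule (hcompact : IsCompact (polyhedron K d))
    (hfree : ∀ s ∈ polyhedron K d, A.region s ∩ B.region s = ∅) :
    -1 ∈ quadModule (pairIneq K d A B) (pairEqn A B) := by
  by_contra hneg
  have hM := isQuadraticModule_quadModule (pairIneq K d A B) (pairEqn A B)
  have hineq := ineq_mem_quadModule (pairIneq K d A B) (pairEqn A B)
  have heqn := mul_eqn_mem_quadModule (pairIneq K d A B) (pairEqn A B)
  generalize quadModule (pairIneq K d A B) (pairEqn A B) = M at *
  have hfacet : ∀ j, (facet K d j : MvPolynomial (PairVars N A.aux B.aux) ℝ) ∈ M :=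
    fun j => hineq (.inl j)
  have hne : (polyhedron K d).Nonempty := by
    rw [Set.nonempty_iff_ne_empty]
    exact fun h => hneg (neg_one_mem_of_polyhedron_eq_empty K d hM Sum.inl hfacet h)
  have hs : ∀ i, X (Sum.inl i) ∈ hM.bounded :=
    X_mem_bounded_of_isCompact K d hM Sum.inl hfacet hcompact hne
  have hA : ∀ t, X (inclA t) ∈ hM.bounded := by
    intro t
    rw [← rename_X inclA t]
    refine hM.mem_bounded_of_preimage (rename inclA) ?_
    refine A.encodes.X_mem_bounded _ (fun i => hineq (.inr (.inl i))) (fun j p => ?_)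
      (fun i => hM.mem_bounded_preimage (rename inclA) (by rw [rename_X]; exact hs i)) t
    simpa [pairEqn] using heqn (.inl j) (rename inclA p)
  have hB : ∀ t, X (inclB t) ∈ hM.bounded := by
    intro t
    rw [← rename_X inclB t]
    refine hM.mem_bounded_of_preimage (rename inclB) ?_
    refine B.encodes.X_mem_bounded _ (fun i => hineq (.inr (.inr i))) (fun j p => ?_)
      (fun i => hM.mem_bounded_preimage (rename inclB) (by rw [rename_X]; exact hs i)) t
    simpa [pairEqn] using heqn (.inr j) (rename inclB p)
  obtain ⟨z, hz⟩ := hM.exists_eval_nonneg (fun t => by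
    rcases t with i | a | j | j
    · exact hs i
    · exact hA (.inr (.inl a))
    · exact hA (.inr (.inr j))
    · exact hB (.inr (.inr j))) hneg
  -- Both `h` and `-h` lie in `M`, so nonnegativity at `z` forces equality.
  have hzero : ∀ j, eval z (pairEqn A B j) = 0 := fun j => le_antisymm
    (by simpa using hz _ (heqn j (-1))) (by simpa using hz _ (heqn j 1))
  have hzA : z ∘ inclA ∈ A.system.solutions :=
    ⟨fun i => by simpa [pairIneq, eval_rename] using hz _ (hineq (.inr (.inl i))),
      fun j => by simpa [pairEqn, eval_rename] using hzero (.inl j)⟩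
  have hzB : z ∘ inclB ∈ B.system.solutions :=
    ⟨fun i => by simpa [pairIneq, eval_rename] using hz _ (hineq (.inr (.inr i))),
      fun j => by simpa [pairEqn, eval_rename] using hzero (.inr j)⟩
  have hmem : (fun i => z (Sum.inl i)) ∈ polyhedron K d := by
    intro j
    have := hz _ (hfacet j)
    simpa [facet, Matrix.mulVec, dotProduct] using this
  -- The two systems share `s` and `x`, so the same point lies in both regions at the same
  -- configuration.
  have hx := Set.mem_inter (A.encodes.mem_image_act hzA) (B.encodes.mem_image_act hzB)
  exact (Set.eq_empty_iff_forall_notMem.1 (hfree _ hmem)) _ hx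

end program

end CertTC

theorem theoremT {N : ℕ} (R : CertTC.Robot N) (S : CertTC.Scene R) {m : ℕ}
    (K : Matrix (Fin m) (Fin N) ℝ) (d : Fin m → ℝ)
    (hcompact : IsCompact (CertTC.polyhedron K d))
    (hlim : CertTC.polyhedron K d ⊆ R.limits)
    (hfree : CertTC.polyhedron K d ⊆ S.free) :
    ∃ ρ₀ : ℕ, ∀ ρ : ℕ, ρ₀ ≤ ρ → ∀ pr ∈ S.pairs,
      CertTC.ProgramFeasible K d (S.body pr.1) (S.body pr.2) ρ := by
  have h : ∀ pr : S.pairs, ∃ ρ : ℕ,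
      CertTC.ProgramFeasible K d (S.body pr.1.1) (S.body pr.1.2) ρ := fun pr =>
    CertTC.exists_programFeasible (CertTC.neg_one_mem_quadModule hcompact
      fun _ hs => hfree hs pr.1 pr.2)
  choose ρ hρ using h
  -- A sum over the finitely many pairs dominates each individual degree.
  refine ⟨∑ pr, ρ pr, fun r hr pr hpr => (hρ ⟨pr, hpr⟩).mono (le_trans ?_ hr)⟩
  exact Finset.single_le_sum (f := ρ) (fun _ _ => Nat.zero_le _) (Finset.mem_univ _)
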